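/- Let $\mathbb F$ be a field, $\mathcal U$ a finite-dimensional $\mathbb F$-vector space and $F\ge 1$ an integer. A linear coded caching scheme with $N=K=3$ and document size $F$ consists of subspaces $W_1,W_2,W_3$ (documents), $Z_1,Z_2,Z_3$ (caches) and $X_{\mathbf d}$, $\mathbf d\in\{1,2,3\}^3$ (messages), of $\mathcal U$ such that $W_1,W_2,W_3$ are linearly independent of dimension $F$ each, and $W_{d_j}\subseteq Z_j+X_{\mathbf d}$ for all $\mathbf d=(d_1,d_2,d_3)$ and all $j$. It achieves $(M,R)$ if $\dim Z_j\le MF$ and $\dim X_{\mathbf d}\le RF$ for all $j$ and $\mathbf d$. It is separated if each $W_i$ is a direct sum $P_{i1}\oplus P_{i2}\oplus P_{i3}$ of subspaces of dimension $F/3$ such that $Z_j\subseteq P_{1j}+P_{2j}+P_{3j}$ for all $j$. It is symmetric if for all permutations $\kappa$ of the users and $\nu$ of the documents some linear automorphism of $\mathcal U$ maps $W_i$ to $W_{\nu(i)}$, $Z_j$ to $Z_{\kappa(j)}$, and $X_{\mathbf d}$ to $X_{\mathbf d'}$, where $d'_{\kappa(j)}=\nu(d_j)$. For a linear isomorphism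 $\nu\colon A\to B$ write $A\oplus B=\{a+\nu(a)\mid a\in A\}$, and similarly $A\oplus B\oplus C=\{a+\nu(a)+\xi(a)\mid a\in A\}$ for linear isomorphisms $\nu\colon A\to B$, $\xi\colon A\to C$. The scheme has ratios $(r_1,\dots,r_5)$ if for every user $j$ there are independent subspaces $A^1_j,A^2_j,A'^3_j,A''^3_j,A^4_j$ of $W_1$, independent subspaces $B^1_j,B^2_j,B'^3_j,B''^3_j,B^4_j$ of $W_2$ and independent subspaces $C^1_j,C^2_j,C'^3_j,C''^3_j,C^4_j$ of $W_3$ such that, for suitable isomorphisms, $Z_j$ is spanned by $A^1_j,\ B^1_j,\ C^1_j$ (individual part); $A^2_j\oplus B^2_j,\ B^2_j\oplus C^2_j$ (Tian part, with one and the same $B^2_j$); $A'^3_j\oplus B'^3_j,\ A''^3_j\oplus C'^3_j,\ B''^3_j\oplus C''^3_j$ (two-way part); and $A^4_j\oplus B^4_j\oplus C^4_j$ (triple-sum part); where, for every $j$, for $i=1,2,4$ the spaces $A^i_j,B^i_j,C^i_j$ have dimension $Fr_i$, the six spaces with superscript $3$ have dimension $Fr_3/2$, and $3Fr_5=F-\dim(A_1+A_2+A_3)$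 with $A_j=A^1_j+A^2_j+A'^3_j+A''^3_j+A^4_j$. **Theorem.** Consider a separated linear scheme with $N=K=3$ that achieves $(M,R)\in\mathbb R^2$. 1. If the scheme is symmetric, then it has ratios $(r_1,\dots,r_5)$ for some real numbers $r_i$. 2. Whenever the scheme has ratios $(r_1,\dots,r_5)$, $$2R+3M\ \ge\ 5-\tfrac32 r_3+3r_5 \qquad\text{and}\qquad 6M+5R\ \ge\ 11+3r_4+\tfrac{15}{2}r_5 .$$ 3. In every case (symmetric or not), $6M+5R\ge 11$. -/

import Mathlib

/-- A linear coded caching scheme over `𝕜` with `N` documents of size `F` and `K` users, in the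
universe `U`: documents `W i`, caches `Z j`, and one broadcast message `X d` for every demand
vector `d`. User `j` requests document `d j` and reconstructs it from `Z j` and `X d`. -/
structure LinearCachingScheme (𝕜 : Type*) (U : Type*) [Field 𝕜] [AddCommGroup U] [Module 𝕜 U]
    (N K F : ℕ) where
  W : Fin N → Submodule 𝕜 U
  Z : Fin K → Submodule 𝕜 U
  X : (Fin K → Fin N) → Submodule 𝕜 U
  indep_W : iSupIndep W
  finrank_W : ∀ i, Module.finrank 𝕜 (W i) = F
  decode : ∀ (d : Fin K → Fin N) (j : Fin K), W (d j) ≤ Z j ⊔ X d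

/-- For a linear isomorphism `ν : A ≃ B`, the subspace `A ⊕_ν B = {a + ν a | a ∈ A}`. -/
def oplusTwo {𝕜 U : Type*} [Field 𝕜] [AddCommGroup U] [Module 𝕜 U] {A B : Submodule 𝕜 U}
    (ν : A ≃ₗ[𝕜] B) : Submodule 𝕜 U :=
  LinearMap.range (A.subtype + B.subtype ∘ₗ ν.toLinearMap)

/-- For linear isomorphisms `ν : A ≃ B` and `ξ : A ≃ C`, the subspace
`A ⊕_ν B ⊕_ξ C = {a + ν a + ξ a | a ∈ A}`. -/
def oplusThree {𝕜 U : Type*} [Field 𝕜] [AddCommGroup U] [Module 𝕜 U] {A B C : Submodule 𝕜 U}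
    (ν : A ≃ₗ[𝕜] B) (ξ : A ≃ₗ[𝕜] C) : Submodule 𝕜 U :=
  LinearMap.range (A.subtype + B.subtype ∘ₗ ν.toLinearMap + C.subtype ∘ₗ ξ.toLinearMap)

/-- A decomposition of a cache `Z` into basic schemes with respect to the three documents `W`.
The five subspaces `part i 0, …, part i 4` of `W i` are independent; `part · 0` carries an
individual scheme, `part · 1` a Tian scheme, `part · 4` a triple-sum scheme, and `part · 2`,
`part · 3` carry the two-way schemes: the `AB`-scheme pairs `part 0 2` with `part 1 2`, the
`AC`-scheme pairs `part 0 3` with `part 2 2`, the `BC`-scheme pairs `part 1 3` with `part 2 3`. -/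
structure CacheDecomposition {𝕜 U : Type*} [Field 𝕜] [AddCommGroup U] [Module 𝕜 U]
    (W : Fin 3 → Submodule 𝕜 U) (Z : Submodule 𝕜 U) where
  part : Fin 3 → Fin 5 → Submodule 𝕜 U
  part_le : ∀ i k, part i k ≤ W i
  indep : ∀ i, iSupIndep (part i)
  tianAB : part 0 1 ≃ₗ[𝕜] part 1 1
  tianBC : part 1 1 ≃ₗ[𝕜] part 2 1
  pairAB : part 0 2 ≃ₗ[𝕜] part 1 2
  pairAC : part 0 3 ≃ₗ[𝕜] part 2 2
  pairBC : part 1 3 ≃ₗ[𝕜] part 2 3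
  tripleAB : part 0 4 ≃ₗ[𝕜] part 1 4
  tripleAC : part 0 4 ≃ₗ[𝕜] part 2 4
  span_eq : Z = (part 0 0 ⊔ part 1 0 ⊔ part 2 0) ⊔ (oplusTwo tianAB ⊔ oplusTwo tianBC) ⊔
    (oplusTwo pairAB ⊔ oplusTwo pairAC ⊔ oplusTwo pairBC) ⊔ oplusThree tripleAB tripleAC

namespace LinearCachingScheme

variable {𝕜 U : Type*} [Field 𝕜] [AddCommGroup U] [Module 𝕜 U] {N K F : ℕ}

/-- The scheme achieves the memory-rate pair `(M, R)`. -/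
def Achieves (S : LinearCachingScheme 𝕜 U N K F) (M R : ℝ) : Prop :=
  (∀ j, (Module.finrank 𝕜 (S.Z j) : ℝ) ≤ M * F) ∧ ∀ d, (Module.finrank 𝕜 (S.X d) : ℝ) ≤ R * F

/-- The caches are separated: every document `W i` is the direct sum of three subspaces `P i 0`,
`P i 1`, `P i 2` of dimension `F / 3` such that each cache `Z j` consists of linear combinations
of the `j`-th parts only. -/
def IsSeparated (S : LinearCachingScheme 𝕜 U 3 3 F) : Prop :=
  ∃ P : Fin 3 → Fin 3 → Submodule 𝕜 U,
    (∀ i, iSupIndep (P i)) ∧ (∀ i, ⨆ j, P i j = S.W i) ∧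
    (∀ i j, 3 * Module.finrank 𝕜 (P i j) = F) ∧ ∀ j, S.Z j ≤ ⨆ i, P i j

/-- Every relabelling `κ` of the users and `ν` of the documents is induced by a linear
automorphism of the universe. The demand `d` becomes the one in which user `κ j` requests
document `ν (d j)`. -/
def IsSymmetric (S : LinearCachingScheme 𝕜 U N K F) : Prop :=
  ∀ (κ : Equiv.Perm (Fin K)) (ν : Equiv.Perm (Fin N)), ∃ e : U ≃ₗ[𝕜] U,
    (∀ i, (S.W i).map e.toLinearMap = S.W (ν i)) ∧
    (∀ j, (S.Z j).map e.toLinearMap = S.Z (κ j)) ∧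
    ∀ d, (S.X d).map e.toLinearMap = S.X fun j => ν (d (κ.symm j))

/-- The scheme has ratios `(r₁, r₂, r₃, r₄, r₅)`: the caches decompose into basic schemes so that,
for every user and every document, the individual, Tian and triple-sum parts have dimensions
`F r₁`, `F r₂`, `F r₄`, each of the two two-way parts has dimension `F r₃ / 2`, and
`3 F r₅` is the codimension in `W 0` of the sum of all the parts of `W 0`. -/
def HasRatios (S : LinearCachingScheme 𝕜 U 3 K F) (r₁ r₂ r₃ r₄ r₅ : ℝ) : Prop :=
  ∃ D : ∀ j, CacheDecomposition S.W (S.Z j),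
    (∀ j i, (Module.finrank 𝕜 ((D j).part i 0) : ℝ) = F * r₁ ∧
      (Module.finrank 𝕜 ((D j).part i 1) : ℝ) = F * r₂ ∧
      (Module.finrank 𝕜 ((D j).part i 2) : ℝ) = F * (r₃ / 2) ∧
      (Module.finrank 𝕜 ((D j).part i 3) : ℝ) = F * (r₃ / 2) ∧
      (Module.finrank 𝕜 ((D j).part i 4) : ℝ) = F * r₄) ∧
    3 * F * r₅ = F - Module.finrank 𝕜 ↥(⨆ j, ⨆ k, (D j).part 0 k)

end LinearCachingScheme

/-! Separation arranges the documents as a 3×3 grid of independent cells `P i j`: `W i` fills row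
`i` and `Z j` lies in column `j`. Take a demand for three distinct documents, relabelled so that
user `i` wants `W i`. Decoding forces `V i = X ⊓ (W i ⊔ Z i)` to have dimension at least `F - dim (Z
i ⊓ W i)`. Since `W i ⊔ Z i` lives on the cross formed by row `i` and column `i`, and two crosses
share only the cells `(i, k)` and `(k, i)`, the three spaces `V i ⊓ V k` are independent inside `X`.
Counting dimensions gives the pairwise bound (`finrank_le_of_pairwise_decoding`), which large
intersections `Z i ⊓ W i` weaken. Decoding the users one after another gives the chain bound
(`finrank_le_of_chain_decoding`), which such intersections strengthen. Averaged over cyclic demands,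
the pairwise bound plus twice the chain bound no longer involves them (`Achieves.combined_bound`).

Caches enter these bounds only through a `CacheCover`. The grid itself is a cover and yields `6M +
5R ≥ 11`. A decomposition into basic schemes gives a finer cover: `r₅` measures what the caches
leave unused, and each triple-sum part makes the hull smaller by twice its dimension. This yields
the second inequality with ratios. The first uses only the pairwise bound, with the intersections
estimated directly from the decomposition.

Ratios exist for symmetric schemes because any cache inside the sum of the documents decomposes
(`exists_cacheDecomposition`), with part dimensions expressed through subspaces built from `W` and
`Z` by sums and intersections. Automorphisms preserve such dimensions, so symmetry equalizes them.
-/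

theorem iSupIndep.finrank_iSup {𝕜 U ι : Type*} [Field 𝕜] [AddCommGroup U] [Module 𝕜 U]
    [FiniteDimensional 𝕜 U] [Fintype ι] {p : ι → Submodule 𝕜 U} (hp : iSupIndep p) :
    Module.finrank 𝕜 ↥(⨆ i, p i) = ∑ i, Module.finrank 𝕜 (p i) := by
  classical
  rw [Submodule.iSup_eq_range_dfinsupp_lsum]
  have h := LinearMap.finrank_range_of_inj
    (f := DFinsupp.lsum ℕ fun i => (p i).subtype) hp.dfinsupp_lsum_injective
  exact h.trans (Module.finrank_directSum 𝕜 fun i => p i)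

theorem Submodule.finrank_iSup_le_sum {𝕜 U ι : Type*} [Field 𝕜] [AddCommGroup U] [Module 𝕜 U]
    [FiniteDimensional 𝕜 U] [Fintype ι] (p : ι → Submodule 𝕜 U) :
    Module.finrank 𝕜 ↥(⨆ i, p i) ≤ ∑ i, Module.finrank 𝕜 (p i) := by
  classical
  rw [Submodule.iSup_eq_range_dfinsupp_lsum]
  exact (LinearMap.finrank_range_le
    (DFinsupp.lsum ℕ fun i => (p i).subtype : (Π₀ i, p i) →ₗ[𝕜] U)).trans
      (Module.finrank_directSum 𝕜 fun i => p i).le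

/-- Projections onto the members of a family of subspaces, each killing all the others. -/
structure ProjectionFamily {𝕜 U ι : Type*} [Field 𝕜] [AddCommGroup U] [Module 𝕜 U]
    (p : ι → Submodule 𝕜 U) (π : ι → U →ₗ[𝕜] U) : Prop where
  mem : ∀ i x, π i x ∈ p i
  apply_self : ∀ i, ∀ x ∈ p i, π i x = x
  apply_other : ∀ i k, i ≠ k → ∀ x ∈ p k, π i x = 0

theorem iSupIndep.exists_projectionFamily {𝕜 U ι : Type*} [Field 𝕜] [AddCommGroup U]
    [Module 𝕜 U] {p : ι → Submodule 𝕜 U} (hp : iSupIndep p) :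
    ∃ π : ι → U →ₗ[𝕜] U, ProjectionFamily p π := by
  classical
  obtain ⟨g, hg⟩ := LinearMap.exists_leftInverse_of_injective
    (DFinsupp.lsum ℕ fun i => (p i).subtype : (Π₀ i, p i) →ₗ[𝕜] U)
    (LinearMap.ker_eq_bot.2 hp.dfinsupp_lsum_injective)
  have hs : ∀ i (x : p i), g x = DFinsupp.single i x := fun i x => by
    simpa using LinearMap.congr_fun hg (DFinsupp.single i x)
  refine ⟨fun i => (p i).subtype ∘ₗ DFinsupp.lapply i ∘ₗ g, ⟨fun i x => ?_, ?_, ?_⟩⟩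
  · exact Submodule.coe_mem _
  · intro i x hx
    simp [hs i ⟨x, hx⟩]
  · intro i k hik x hx
    simp [hs k ⟨x, hx⟩, DFinsupp.single_eq_of_ne hik]

namespace ProjectionFamily

variable {𝕜 U ι : Type*} [Field 𝕜] [AddCommGroup U] [Module 𝕜 U] {p : ι → Submodule 𝕜 U}
  {π : ι → U →ₗ[𝕜] U}

theorem sum_apply [Fintype ι] (h : ProjectionFamily p π) {x : U} (hx : x ∈ ⨆ i, p i) :
    ∑ i, π i x = x := by
  classical
  refine Submodule.iSup_induction p (motive := fun x => ∑ i, π i x = x) hx ?_ (by simp) ?_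
  · intro k x hx
    rw [Finset.sum_eq_single k (fun i _ hik => h.apply_other i k hik x hx) (by simp),
      h.apply_self k x hx]
  · intro x y hx hy
    simp_rw [map_add, Finset.sum_add_distrib, hx, hy]

/-- Projections onto a family of families of subspaces, obtained by composition. -/
theorem comp {κ : Type*} {P : ι → κ → Submodule 𝕜 U} {σ : ι → κ → U →ₗ[𝕜] U}
    (h : ProjectionFamily p π) (hσ : ∀ i, ProjectionFamily (P i) (σ i))
    (hP : ∀ i j, P i j ≤ p i) :
    ProjectionFamily (fun a : ι × κ => P a.1 a.2) (fun a => σ a.1 a.2 ∘ₗ π a.1) where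
  mem a x := (hσ a.1).mem _ _
  apply_self a x hx := by
    simp [h.apply_self _ x (hP _ _ hx), (hσ a.1).apply_self _ x hx]
  apply_other a b hab x hx := by
    by_cases h1 : a.1 = b.1
    · obtain ⟨i, j⟩ := a
      obtain ⟨i', j'⟩ := b
      obtain rfl : i = i' := h1
      have h2 : j ≠ j' := fun e => hab (by rw [e])
      simp [h.apply_self _ x (hP _ _ hx), (hσ i).apply_other j j' h2 x hx]
    · simp [h.apply_other _ _ h1 x (hP _ _ hx)]

end ProjectionFamily

/-! ### Dimension counts for decoding -/

/-- Enlarge `X` by `Z₁`, then by `Z₂`, then by what `Z₃` adds. After the first step `W₁` is known,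
so `Z₂ ⊓ W₁` is counted twice; after the second `W₁` and `W₂` are known, so `Z₃` costs at most `Q`.
-/
theorem finrank_le_of_chain_decoding {𝕜 U : Type*} [Field 𝕜] [AddCommGroup U] [Module 𝕜 U]
    [FiniteDimensional 𝕜 U] {W₁ W₂ W₃ Z₁ Z₂ Z₃ X Q : Submodule 𝕜 U}
    (h₁ : W₁ ≤ Z₁ ⊔ X) (h₂ : W₂ ≤ Z₂ ⊔ X) (h₃ : W₃ ≤ Z₃ ⊔ X) (hQ : Z₃ ≤ W₁ ⊔ W₂ ⊔ Q) :
    Module.finrank 𝕜 ↥(W₁ ⊔ W₂ ⊔ W₃) + Module.finrank 𝕜 ↥(Z₂ ⊓ W₁) ≤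
      Module.finrank 𝕜 X + Module.finrank 𝕜 Z₁ + Module.finrank 𝕜 Z₂ + Module.finrank 𝕜 Q := by
  have e₁ := Submodule.finrank_add_le_finrank_add_finrank Z₁ X
  have e₂ := Submodule.finrank_sup_add_finrank_inf_eq Z₂ (Z₁ ⊔ X)
  have e₃ : Module.finrank 𝕜 ↥(Z₂ ⊓ W₁) ≤ Module.finrank 𝕜 ↥(Z₂ ⊓ (Z₁ ⊔ X)) :=
    Submodule.finrank_mono (inf_le_inf_left _ h₁)
  have e₄ := Submodule.finrank_add_le_finrank_add_finrank (Z₂ ⊔ (Z₁ ⊔ X)) Q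
  have f₁ : W₁ ≤ Z₂ ⊔ (Z₁ ⊔ X) ⊔ Q := h₁.trans (le_sup_right.trans le_sup_left)
  have f₂ : W₂ ≤ Z₂ ⊔ (Z₁ ⊔ X) ⊔ Q :=
    h₂.trans ((sup_le_sup_left le_sup_right _).trans le_sup_left)
  have f₃ : W₃ ≤ Z₂ ⊔ (Z₁ ⊔ X) ⊔ Q :=
    h₃.trans (sup_le (hQ.trans (sup_le (sup_le f₁ f₂) le_sup_right))
      ((le_sup_right.trans le_sup_right).trans le_sup_left))
  have e₅ := Submodule.finrank_mono (sup_le (sup_le f₁ f₂) f₃)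
  omega

/-- By the modular law, the part of `X` inside `W ⊔ Z` already suffices to decode `W` from `Z`. -/
theorem finrank_le_finrank_inf_decoding_add {𝕜 U : Type*} [Field 𝕜] [AddCommGroup U]
    [Module 𝕜 U] [FiniteDimensional 𝕜 U] {W Z X : Submodule 𝕜 U} (h : W ≤ Z ⊔ X) :
    Module.finrank 𝕜 W ≤ Module.finrank 𝕜 ↥(X ⊓ (W ⊔ Z)) + Module.finrank 𝕜 ↥(Z ⊓ W) := by
  have e₁ : W ⊔ Z ≤ Z ⊔ X ⊓ (W ⊔ Z) := by
    rw [← sup_inf_assoc_of_le X (le_sup_right : Z ≤ W ⊔ Z)]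
    exact le_inf (sup_le h le_sup_left) le_rfl
  have e₂ := Submodule.finrank_mono e₁
  have e₃ := Submodule.finrank_add_le_finrank_add_finrank Z (X ⊓ (W ⊔ Z))
  have e₄ := Submodule.finrank_sup_add_finrank_inf_eq W Z
  rw [inf_comm W Z] at e₄
  omega

theorem finrank_inf_add_le_of_le_sup {𝕜 U : Type*} [Field 𝕜] [AddCommGroup U]
    [Module 𝕜 U] [FiniteDimensional 𝕜 U] {T X H : Submodule 𝕜 U} (h : T ≤ X ⊔ H) :
    Module.finrank 𝕜 ↥(X ⊓ H) + Module.finrank 𝕜 T ≤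
      Module.finrank 𝕜 X + Module.finrank 𝕜 H := by
  have e₁ := Submodule.finrank_mono h
  have e₂ := Submodule.finrank_sup_add_finrank_inf_eq X H
  omega

/-! ### The grid of cells of a separated scheme -/

section Projections

variable {𝕜 U : Type*} [Field 𝕜] [AddCommGroup U] [Module 𝕜 U]
  {W : Fin 3 → Submodule 𝕜 U} {P : Fin 3 → Fin 3 → Submodule 𝕜 U} {Z : Fin 3 → Submodule 𝕜 U}

theorem exists_separating_projections (hW : iSupIndep W) (hPi : ∀ i, iSupIndep (P i))
    (hPW : ∀ i, ⨆ j, P i j = W i) :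
    ∃ ρ : Fin 3 × Fin 3 → U →ₗ[𝕜] U, ProjectionFamily (fun a => P a.1 a.2) ρ := by
  obtain ⟨π, hπ⟩ := hW.exists_projectionFamily
  choose σ hσ using fun i => (hPi i).exists_projectionFamily
  exact ⟨_, hπ.comp hσ fun i j => (le_iSup (P i) j).trans (hPW i).le⟩

variable {ρ : Fin 3 × Fin 3 → U →ₗ[𝕜] U}

/-- The cell `(u, v)` lies outside the cross of row `i` and column `i`. -/
theorem ProjectionFamily.sup_le_ker (hρ : ProjectionFamily (fun a : Fin 3 × Fin 3 => P a.1 a.2) ρ)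
    (hPW : ∀ i, ⨆ j, P i j = W i) (hZ : ∀ j, Z j ≤ ⨆ i, P i j) {u v i : Fin 3}
    (hu : i ≠ u) (hv : i ≠ v) : W i ⊔ Z i ≤ LinearMap.ker (ρ (u, v)) := by
  refine sup_le ?_ ((hZ i).trans ?_)
  · rw [← hPW i]
    exact iSup_le fun j x hx => hρ.apply_other (u, v) (i, j) (by simp [hu.symm]) x hx
  · exact iSup_le fun j x hx => hρ.apply_other (u, v) (j, i) (by simp [hv.symm]) x hx

theorem ProjectionFamily.eq_add_of_mem_inf
    (hρ : ProjectionFamily (fun a : Fin 3 × Fin 3 => P a.1 a.2) ρ)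
    (hPW : ∀ i, ⨆ j, P i j = W i) (hZ : ∀ j, Z j ≤ ⨆ i, P i j) {i k : Fin 3} (hik : i ≠ k)
    {x : U} (hx : x ∈ (W i ⊔ Z i) ⊓ (W k ⊔ Z k)) : x = ρ (i, k) x + ρ (k, i) x := by
  have hle : W i ⊔ Z i ≤ ⨆ a : Fin 3 × Fin 3, P a.1 a.2 := by
    refine sup_le ?_ ((hZ i).trans ?_)
    · rw [← hPW i]
      exact iSup_le fun j => le_iSup (fun a : Fin 3 × Fin 3 => P a.1 a.2) (i, j)
    · exact iSup_le fun j => le_iSup (fun a : Fin 3 × Fin 3 => P a.1 a.2) (j, i)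
  conv_lhs => rw [← hρ.sum_apply (hle hx.1)]
  rw [← Finset.sum_pair (f := fun a => ρ a x) (a := (i, k)) (b := (k, i))
    (by simp [hik])]
  refine (Finset.sum_subset (Finset.subset_univ _) fun a _ ha => ?_).symm
  obtain ⟨u, v⟩ := a
  by_cases h1 : i ≠ u ∧ i ≠ v
  · exact hρ.sup_le_ker hPW hZ h1.1 h1.2 hx.1
  by_cases h2 : k ≠ u ∧ k ≠ v
  · exact hρ.sup_le_ker hPW hZ h2.1 h2.2 hx.2
  · grind

/-- A common vector has components only in the cells `(i, k)` and `(k, i)`. Subtracting the one that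
lies in `W i` leaves the other in `W i ⊔ Z i`, and likewise for `k`. -/
theorem ProjectionFamily.inf_le_sup
    (hρ : ProjectionFamily (fun a : Fin 3 × Fin 3 => P a.1 a.2) ρ)
    (hPW : ∀ i, ⨆ j, P i j = W i) (hZ : ∀ j, Z j ≤ ⨆ i, P i j) {i k : Fin 3} (hik : i ≠ k) :
    (W i ⊔ Z i) ⊓ (W k ⊔ Z k) ≤ (W i ⊔ Z i) ⊓ W k ⊔ (W k ⊔ Z k) ⊓ W i := by
  intro x hx
  have hx' := hρ.eq_add_of_mem_inf hPW hZ hik hx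
  have h1 : ρ (i, k) x ∈ W i := by
    rw [← hPW i]
    exact (le_iSup (P i) k) (hρ.mem (i, k) x)
  have h2 : ρ (k, i) x ∈ W k := by
    rw [← hPW k]
    exact (le_iSup (P k) i) (hρ.mem (k, i) x)
  have h3 : ρ (i, k) x = x - ρ (k, i) x := eq_sub_of_add_eq hx'.symm
  have h4 : ρ (k, i) x = x - ρ (i, k) x := eq_sub_of_add_eq' hx'.symm
  rw [hx', add_comm]
  refine Submodule.add_mem_sup ⟨?_, h2⟩ ⟨?_, h1⟩
  · rw [h4]
    exact sub_mem hx.1 (Submodule.mem_sup_left h1)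
  · rw [h3]
    exact sub_mem hx.2 (Submodule.mem_sup_left h2)

theorem ProjectionFamily.disjoint_inf
    (hρ : ProjectionFamily (fun a : Fin 3 × Fin 3 => P a.1 a.2) ρ)
    (hPW : ∀ i, ⨆ j, P i j = W i) (hZ : ∀ j, Z j ≤ ⨆ i, P i j) {i k : Fin 3} (hik : i ≠ k)
    {Y : Submodule 𝕜 U}
    (h₁ : Y ≤ LinearMap.ker (ρ (i, k))) (h₂ : Y ≤ LinearMap.ker (ρ (k, i))) :
    Disjoint ((W i ⊔ Z i) ⊓ (W k ⊔ Z k)) Y := by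
  refine Submodule.disjoint_def.2 fun x hx hY => ?_
  rw [hρ.eq_add_of_mem_inf hPW hZ hik hx, LinearMap.mem_ker.1 (h₁ hY),
    LinearMap.mem_ker.1 (h₂ hY), add_zero]

end Projections

/-! ### The pairwise bound -/

theorem finrank_sup_three_of_disjoint {𝕜 U : Type*} [Field 𝕜] [AddCommGroup U] [Module 𝕜 U]
    [FiniteDimensional 𝕜 U] {A B C : Submodule 𝕜 U} (h : Disjoint B C) (h' : Disjoint A (B ⊔ C)) :
    Module.finrank 𝕜 ↥(A ⊔ (B ⊔ C)) =
      Module.finrank 𝕜 A + (Module.finrank 𝕜 B + Module.finrank 𝕜 C) := by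
  have e₁ := Submodule.finrank_sup_add_finrank_inf_eq A (B ⊔ C)
  have e₂ := Submodule.finrank_sup_add_finrank_inf_eq B C
  rw [h'.eq_bot, finrank_bot] at e₁
  rw [h.eq_bot, finrank_bot] at e₂
  omega

/-- Each pair `V i`, `V k` lies in a small slice of `X`, so `V i ⊓ V k` is large; the three
intersections are independent and all lie in `X ⊓ ⨆ j, G j`, so their sum cannot be too large. -/
theorem finrank_le_of_pairwise_decoding {𝕜 U : Type*} [Field 𝕜] [AddCommGroup U] [Module 𝕜 U]
    [FiniteDimensional 𝕜 U] {W Z G : Fin 3 → Submodule 𝕜 U} {P Q : Fin 3 → Fin 3 → Submodule 𝕜 U}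
    {X : Submodule 𝕜 U} {F : ℕ}
    (hW : iSupIndep W) (hF : ∀ i, Module.finrank 𝕜 (W i) = F)
    (hPi : ∀ i, iSupIndep (P i)) (hPW : ∀ i, ⨆ j, P i j = W i) (hZP : ∀ j, Z j ≤ ⨆ i, P i j)
    (hZQ : ∀ j, Z j ≤ ⨆ i, Q i j) (hQW : ∀ i j, Q i j ≤ W i) (hZG : ∀ j, Z j ≤ G j)
    (hG : ∀ i j k, i ≠ k → (W i ⊔ Z j) ⊓ W k ≤ G j) (hX : ∀ i, W i ≤ Z i ⊔ X) :
    12 * F ≤ 4 * Module.finrank 𝕜 X + 2 * ∑ i, Module.finrank 𝕜 ↥(Z i ⊓ W i) +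
      ∑ i, ∑ j, Module.finrank 𝕜 (Q i j) + ∑ j, Module.finrank 𝕜 (G j) := by
  obtain ⟨ρ, hρ⟩ := exists_separating_projections hW hPi hPW
  have hT : Module.finrank 𝕜 ↥(⨆ i, W i) = 3 * F := by
    rw [hW.finrank_iSup]
    simp [hF]
  set V : Fin 3 → Submodule 𝕜 U := fun i => X ⊓ (W i ⊔ Z i) with hV
  have hVd : ∀ i, F ≤ Module.finrank 𝕜 (V i) + Module.finrank 𝕜 ↥(Z i ⊓ W i) := fun i =>
    (hF i).symm.le.trans (finrank_le_finrank_inf_decoding_add (hX i))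
  have hpair : ∀ i k l : Fin 3, i ≠ k → i ≠ l → k ≠ l →
      Module.finrank 𝕜 (V i) + Module.finrank 𝕜 (V k) + F ≤ Module.finrank 𝕜 ↥(V i ⊓ V k) +
        Module.finrank 𝕜 X + ∑ j, Module.finrank 𝕜 (Q l j) := by
    intro i k l hik hil hkl
    -- `H` contains all caches, so `X ⊔ H` contains all documents; this bounds `X ⊓ H`, which
    -- contains `V i ⊔ V k`.
    set H := (W i ⊔ W k) ⊔ ⨆ j, Q l j with hH
    have hZH : ∀ j, Z j ≤ H := fun j => (hZQ j).trans <| iSup_le fun m => by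
      obtain rfl | rfl | rfl : m = i ∨ m = k ∨ m = l := by omega
      · exact (hQW _ _).trans (le_sup_left.trans le_sup_left)
      · exact (hQW _ _).trans (le_sup_right.trans le_sup_left)
      · exact (le_iSup (Q m) j).trans le_sup_right
    have h1 : V i ⊔ V k ≤ X ⊓ H := sup_le
      (inf_le_inf_left _ (sup_le (le_sup_left.trans le_sup_left) (hZH i)))
      (inf_le_inf_left _ (sup_le (le_sup_right.trans le_sup_left) (hZH k)))
    have h2 : ⨆ i, W i ≤ X ⊔ H := iSup_le fun m =>
      (hX m).trans (sup_le ((hZH m).trans le_sup_right) le_sup_left)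
    have h3 := finrank_inf_add_le_of_le_sup h2
    have h4 := Submodule.finrank_mono h1
    have h5 := Submodule.finrank_sup_add_finrank_inf_eq (V i) (V k)
    have h6 := Submodule.finrank_add_le_finrank_add_finrank (W i ⊔ W k) (⨆ j, Q l j)
    have h7 := Submodule.finrank_add_le_finrank_add_finrank (W i) (W k)
    have h8 := Submodule.finrank_iSup_le_sum (fun j => Q l j)
    rw [hF, hF] at h7
    rw [← hH] at h6
    omega
  have hGsup : ∀ i k, i ≠ k → V i ⊓ V k ≤ X ⊓ ⨆ j, G j := fun i k hik => by
    refine le_inf (inf_le_left.trans inf_le_left) ((inf_le_inf inf_le_right inf_le_right).trans ?_)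
    exact (hρ.inf_le_sup hPW hZP hik).trans (sup_le ((hG _ _ _ hik).trans (le_iSup G i))
      ((hG _ _ _ hik.symm).trans (le_iSup G k)))
  have hker : ∀ {i u v : Fin 3} (k : Fin 3), i ≠ u → i ≠ v →
      V i ⊓ V k ≤ LinearMap.ker (ρ (u, v)) := fun k hu hv =>
    (inf_le_left.trans inf_le_right).trans (hρ.sup_le_ker hPW hZP hu hv)
  have hle : ∀ i k, V i ⊓ V k ≤ (W i ⊔ Z i) ⊓ (W k ⊔ Z k) := fun i k =>
    inf_le_inf inf_le_right inf_le_right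
  -- Each intersection sits in two cells on which the projections kill the other intersections,
  -- because each of those lies in a cross avoiding these cells.
  have hd := finrank_sup_three_of_disjoint (A := V 0 ⊓ V 1) (B := V 2 ⊓ V 0) (C := V 1 ⊓ V 2)
    ((hρ.disjoint_inf hPW hZP (by decide) (hker 2 (by decide) (by decide))
      (hker 2 (by decide) (by decide))).mono_left (hle 2 0))
    ((hρ.disjoint_inf hPW hZP (by decide)
      (sup_le (hker 0 (by decide) (by decide))
        (inf_comm (V 1) (V 2) ▸ hker 1 (by decide) (by decide)))
      (sup_le (hker 0 (by decide) (by decide))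
        (inf_comm (V 1) (V 2) ▸ hker 1 (by decide) (by decide)))).mono_left (hle 0 1))
  have hs := Submodule.finrank_mono (sup_le (hGsup 0 1 (by decide))
    (sup_le (hGsup 2 0 (by decide)) (hGsup 1 2 (by decide))))
  have hXG : ⨆ i, W i ≤ X ⊔ ⨆ j, G j := iSup_le fun m =>
    (hX m).trans (sup_le (((hZG m).trans (le_iSup G m)).trans le_sup_right) le_sup_left)
  have hs' := finrank_inf_add_le_of_le_sup hXG
  have hg := Submodule.finrank_iSup_le_sum G
  have p1 := hpair 0 1 2 (by decide) (by decide) (by decide)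
  have p2 := hpair 2 0 1 (by decide) (by decide) (by decide)
  have p3 := hpair 1 2 0 (by decide) (by decide) (by decide)
  have v0 := hVd 0
  have v1 := hVd 1
  have v2 := hVd 2
  rw [Fin.sum_univ_three (f := fun i => Module.finrank 𝕜 ↥(Z i ⊓ W i)),
    Fin.sum_univ_three (f := fun i => ∑ j, Module.finrank 𝕜 (Q i j))]
  omega

/-- A family `Q` of subspaces of the documents `W` that together contain the cache `Z`, and a
subspace `G` that contains `Z` and everything that `Z` reveals about one document to a user who
knows another one. -/
structure CacheCover {𝕜 U : Type*} [Field 𝕜] [AddCommGroup U] [Module 𝕜 U]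
    (W : Fin 3 → Submodule 𝕜 U) (Z : Submodule 𝕜 U) (Q : Fin 3 → Submodule 𝕜 U)
    (G : Submodule 𝕜 U) : Prop where
  le_iSup : Z ≤ ⨆ i, Q i
  le_document : ∀ i, Q i ≤ W i
  le_hull : Z ≤ G
  inf_le_hull : ∀ i k, i ≠ k → (W i ⊔ Z) ⊓ W k ≤ G

/-- A vector of `W k` in row `i` plus column `j`, with `i ≠ k`, has its only component in the cell
`(k, j)`. -/
theorem cacheCover_of_separated {𝕜 U : Type*} [Field 𝕜] [AddCommGroup U] [Module 𝕜 U]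
    {W Z : Fin 3 → Submodule 𝕜 U} {P : Fin 3 → Fin 3 → Submodule 𝕜 U}
    (hW : iSupIndep W) (hPi : ∀ i, iSupIndep (P i)) (hPW : ∀ i, ⨆ j, P i j = W i)
    (hZ : ∀ j, Z j ≤ ⨆ i, P i j) (j : Fin 3) :
    CacheCover W (Z j) (fun i => P i j) (⨆ i, P i j) where
  le_iSup := hZ j
  le_document i := hPW i ▸ le_iSup (P i) j
  le_hull := hZ j
  inf_le_hull i k hik x hx := by
    obtain ⟨ρ, hρ⟩ := exists_separating_projections hW hPi hPW
    have hxk : x ∈ ⨆ a : Fin 3 × Fin 3, P a.1 a.2 := by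
      have : W k ≤ ⨆ a : Fin 3 × Fin 3, P a.1 a.2 := by
        rw [← hPW k]
        exact iSup_le fun l => le_iSup (fun a : Fin 3 × Fin 3 => P a.1 a.2) (k, l)
      exact this hx.2
    have hker : ∀ u v, u ≠ k ∨ v ≠ j → ρ (u, v) x = 0 := by
      intro u v huv
      by_cases hu : u = k
      · have hv : v ≠ j := huv.resolve_left fun h => h hu
        have : W i ⊔ Z j ≤ LinearMap.ker (ρ (u, v)) := by
          refine sup_le ?_ ((hZ j).trans ?_)
          · rw [← hPW i]
            exact iSup_le fun l y hy =>
              hρ.apply_other (u, v) (i, l) (by simp [hu, hik.symm]) y hy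
          · exact iSup_le fun l y hy => hρ.apply_other (u, v) (l, j) (by simp [hv]) y hy
        exact this hx.1
      · have : W k ≤ LinearMap.ker (ρ (u, v)) := by
          rw [← hPW k]
          exact iSup_le fun l y hy => hρ.apply_other (u, v) (k, l) (by simp [hu]) y hy
        exact this hx.2
    rw [← hρ.sum_apply hxk, Finset.sum_eq_single (k, j)]
    · exact (le_iSup (fun i => P i j) k) (hρ.mem (k, j) x)
    · rintro ⟨u, v⟩ - huv
      exact hker u v (by grind)
    · simp

/-! ### Rate bounds from cache covers -/

namespace LinearCachingScheme

variable {𝕜 U : Type*} [Field 𝕜] [AddCommGroup U] [Module 𝕜 U] [FiniteDimensional 𝕜 U] {F : ℕ}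
  {S : LinearCachingScheme 𝕜 U 3 3 F} {Q : Fin 3 → Fin 3 → Submodule 𝕜 U}
  {G : Fin 3 → Submodule 𝕜 U} {M R : ℝ}

/-- Summing over the cyclic demands `j ↦ j + δ` makes every pair of a user and a document occur
equally often. -/
theorem Achieves.pairwise_bound (hMR : S.Achieves M R) (hS : S.IsSeparated)
    (hC : ∀ j, CacheCover S.W (S.Z j) (fun i => Q i j) (G j)) :
    (36 * F : ℝ) ≤ 12 * R * F + 2 * ∑ i, ∑ j, (Module.finrank 𝕜 ↥(S.Z j ⊓ S.W i) : ℝ) +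
      3 * ∑ i, ∑ j, (Module.finrank 𝕜 (Q i j) : ℝ) + 3 * ∑ j, (Module.finrank 𝕜 (G j) : ℝ) := by
  obtain ⟨P, hPi, hPW, -, hZ⟩ := hS
  have key : ∀ δ : Fin 3, (12 * F : ℝ) ≤ 4 * (R * F) +
      2 * ∑ i, (Module.finrank 𝕜 ↥(S.Z i ⊓ S.W (i + δ)) : ℝ) +
      ∑ i, ∑ j, (Module.finrank 𝕜 (Q (i + δ) j) : ℝ) + ∑ j, (Module.finrank 𝕜 (G j) : ℝ) := by
    intro δ
    have hsup : ∀ p : Fin 3 → Submodule 𝕜 U, ⨆ i, p (i + δ) = ⨆ i, p i := fun p =>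
      (Equiv.addRight δ).iSup_comp (g := p)
    have h := finrank_le_of_pairwise_decoding (W := fun i => S.W (i + δ)) (Z := S.Z) (G := G)
      (P := fun i => P (i + δ)) (Q := fun i => Q (i + δ)) (X := S.X fun i => i + δ) (F := F)
      (S.indep_W.comp (add_left_injective δ)) (fun i => S.finrank_W _) (fun i => hPi _)
      (fun i => hPW _) (fun j => (hsup fun i => P i j).symm ▸ hZ j)
      (fun j => (hsup fun i => Q i j).symm ▸ (hC j).le_iSup) (fun i j => (hC j).le_document _)
      (fun j => (hC j).le_hull)
      (fun i j k hik => (hC j).inf_le_hull _ _ fun h => hik (add_left_injective δ h))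
      (fun i => S.decode (fun i => i + δ) i)
    have hX := hMR.2 fun i => i + δ
    have h' : (12 * F : ℝ) ≤ 4 * Module.finrank 𝕜 ↥(S.X fun i => i + δ) +
      2 * ∑ i, (Module.finrank 𝕜 ↥(S.Z i ⊓ S.W (i + δ)) : ℝ) +
      ∑ i, ∑ j, (Module.finrank 𝕜 (Q (i + δ) j) : ℝ) + ∑ j, (Module.finrank 𝕜 (G j) : ℝ) := by
      exact_mod_cast h
    linarith
  have k0 := key 0
  have k1 := key 1
  have k2 := key 2
  simp only [Fin.sum_univ_three, Fin.reduceAdd, Fin.isValue] at k0 k1 k2 ⊢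
  linarith

/-- The nine chains start at user `u` under the demand `j ↦ j + δ`; each pair of a cache and a
document occurs once as an intersection and once as a `Q`. -/
theorem Achieves.chain_bound (hMR : S.Achieves M R)
    (hC : ∀ j, CacheCover S.W (S.Z j) (fun i => Q i j) (G j)) :
    (27 * F : ℝ) + ∑ i, ∑ j, (Module.finrank 𝕜 ↥(S.Z j ⊓ S.W i) : ℝ) ≤
      9 * R * F + 6 * ∑ j, (Module.finrank 𝕜 (S.Z j) : ℝ) +
        ∑ i, ∑ j, (Module.finrank 𝕜 (Q i j) : ℝ) := by
  have hT : Module.finrank 𝕜 ↥(⨆ i, S.W i) = 3 * F := by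
    rw [S.indep_W.finrank_iSup]
    simp [S.finrank_W]
  have key : ∀ δ u : Fin 3, (3 * F : ℝ) + Module.finrank 𝕜 ↥(S.Z (u + 1) ⊓ S.W (u + δ)) ≤
      R * F + Module.finrank 𝕜 (S.Z u) + Module.finrank 𝕜 (S.Z (u + 1)) +
        Module.finrank 𝕜 (Q (u + 2 + δ) (u + 2)) := by
    intro δ u
    have hcases : ∀ m : Fin 3, m = u + δ ∨ m = u + 1 + δ ∨ m = u + 2 + δ := by
      revert δ u
      decide
    have h := finrank_le_of_chain_decoding (S.decode (fun i => i + δ) u)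
      (S.decode (fun i => i + δ) (u + 1)) (S.decode (fun i => i + δ) (u + 2))
      (Q := Q (u + 2 + δ) (u + 2)) ((hC (u + 2)).le_iSup.trans (iSup_le fun m => by
        rcases hcases m with h | h | h
        · exact (((hC (u + 2)).le_document m).trans (by rw [h]; exact le_sup_left)).trans
            le_sup_left
        · exact (((hC (u + 2)).le_document m).trans (by rw [h]; exact le_sup_right)).trans
            le_sup_left
        · rw [h]
          exact le_sup_right))
    have hle : ⨆ i, S.W i ≤ S.W (u + δ) ⊔ S.W (u + 1 + δ) ⊔ S.W (u + 2 + δ) :=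
      iSup_le fun m => by
        rcases hcases m with h | h | h <;> rw [h]
        · exact le_sup_left.trans le_sup_left
        · exact le_sup_right.trans le_sup_left
        · exact le_sup_right
    have hle' := Submodule.finrank_mono hle
    rw [hT] at hle'
    have h' := (Nat.add_le_add_right hle' _).trans h
    have hX := hMR.2 fun i => i + δ
    have h'' : (3 * F : ℝ) + Module.finrank 𝕜 ↥(S.Z (u + 1) ⊓ S.W (u + δ)) ≤
      Module.finrank 𝕜 ↥(S.X fun i => i + δ) + Module.finrank 𝕜 (S.Z u) +
        Module.finrank 𝕜 (S.Z (u + 1)) + Module.finrank 𝕜 (Q (u + 2 + δ) (u + 2)) := by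
      exact_mod_cast h'
    linarith
  have hsum := Finset.sum_le_sum fun (δ : Fin 3) (_ : δ ∈ Finset.univ) =>
    Finset.sum_le_sum fun (u : Fin 3) (_ : u ∈ Finset.univ) => key δ u
  simp only [Fin.sum_univ_three, Fin.reduceAdd, Fin.isValue] at hsum ⊢
  linarith

/-- The two lower bounds on the rate combined, with the intersections of caches and documents
eliminated. -/
theorem Achieves.combined_bound (hMR : S.Achieves M R) (hS : S.IsSeparated)
    (hC : ∀ j, CacheCover S.W (S.Z j) (fun i => Q i j) (G j)) :
    (90 * F : ℝ) ≤ 30 * R * F + 36 * M * F +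
      5 * ∑ i, ∑ j, (Module.finrank 𝕜 (Q i j) : ℝ) + 3 * ∑ j, (Module.finrank 𝕜 (G j) : ℝ) := by
  have h1 := hMR.pairwise_bound hS hC
  have h2 := hMR.chain_bound hC
  have h3 : ∑ j, (Module.finrank 𝕜 (S.Z j) : ℝ) ≤ ∑ _j : Fin 3, M * F :=
    Finset.sum_le_sum fun j _ => hMR.1 j
  simp only [Finset.sum_const, Finset.card_univ, Fintype.card_fin, nsmul_eq_mul] at h3
  push_cast at h3
  linarith

theorem Achieves.six_mul_add_five_mul_ge (hF : 0 < F) (hMR : S.Achieves M R)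
    (hS : S.IsSeparated) : 6 * M + 5 * R ≥ 11 := by
  obtain ⟨P, hPi, hPW, hPF, hZ⟩ := id hS
  have h := hMR.combined_bound hS (cacheCover_of_separated S.indep_W hPi hPW hZ)
  have hP : ∀ i j, (Module.finrank 𝕜 (P i j) : ℝ) = F / 3 := fun i j => by
    have : (3 * Module.finrank 𝕜 (P i j) : ℝ) = F := by exact_mod_cast hPF i j
    linarith
  have hG : ∀ j, (Module.finrank 𝕜 ↥(⨆ i, P i j) : ℝ) ≤ F := fun j => by
    have h1 : (Module.finrank 𝕜 ↥(⨆ i, P i j) : ℝ) ≤ ∑ i, (Module.finrank 𝕜 (P i j) : ℝ) := by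
      exact_mod_cast Submodule.finrank_iSup_le_sum fun i => P i j
    simp only [hP, Fin.sum_univ_three] at h1
    linarith
  have hGs := Finset.sum_le_sum fun (j : Fin 3) (_ : j ∈ Finset.univ) => hG j
  simp only [hP, Finset.sum_const, Finset.card_univ, Fintype.card_fin, nsmul_eq_mul] at h hGs
  push_cast at h hGs
  have hF' : (0 : ℝ) < F := by exact_mod_cast hF
  have : (11 - (6 * M + 5 * R)) * F ≤ 0 := by linarith
  nlinarith

end LinearCachingScheme

/-! ### Sums along isomorphisms -/

section Oplus

variable {𝕜 U : Type*} [Field 𝕜] [AddCommGroup U] [Module 𝕜 U] {A B C Y : Submodule 𝕜 U}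
  {ν : A ≃ₗ[𝕜] B} {ξ : A ≃ₗ[𝕜] C}

theorem oplusTwo_le_iff : oplusTwo ν ≤ Y ↔ ∀ a : A, (a : U) + ν a ∈ Y := by
  simp [oplusTwo, LinearMap.range_le_iff_comap, Submodule.eq_top_iff']

theorem oplusThree_le_iff : oplusThree ν ξ ≤ Y ↔ ∀ a : A, (a : U) + ν a + ξ a ∈ Y := by
  simp [oplusThree, LinearMap.range_le_iff_comap, Submodule.eq_top_iff']

theorem oplusTwo_le_sup : oplusTwo ν ≤ A ⊔ B :=
  oplusTwo_le_iff.2 fun a => Submodule.add_mem_sup a.2 (ν a).2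

theorem oplusThree_le_sup : oplusThree ν ξ ≤ A ⊔ B ⊔ C :=
  oplusThree_le_iff.2 fun a => Submodule.add_mem_sup (Submodule.add_mem_sup a.2 (ν a).2) (ξ a).2

theorem finrank_oplusThree_le [FiniteDimensional 𝕜 U] :
    Module.finrank 𝕜 (oplusThree ν ξ) ≤ Module.finrank 𝕜 A :=
  LinearMap.finrank_range_le _

theorem right_le_of_oplusTwo_le (h : oplusTwo ν ≤ Y) (hA : A ≤ Y) : B ≤ Y := fun b hb => by
  have := sub_mem (oplusTwo_le_iff.1 h (ν.symm ⟨b, hb⟩)) (hA (ν.symm ⟨b, hb⟩).2)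
  simpa using this

theorem left_le_of_oplusTwo_le (h : oplusTwo ν ≤ Y) (hB : B ≤ Y) : A ≤ Y := fun a ha => by
  have := sub_mem (oplusTwo_le_iff.1 h ⟨a, ha⟩) (hB (ν ⟨a, ha⟩).2)
  simpa using this

theorem middle_le_of_oplusThree_le (h : oplusThree ν ξ ≤ Y) (hA : A ≤ Y) (hC : C ≤ Y) :
    B ≤ Y := fun b hb => by
  have := sub_mem (sub_mem (oplusThree_le_iff.1 h (ν.symm ⟨b, hb⟩)) (hC (ξ (ν.symm ⟨b, hb⟩)).2))
    (hA (ν.symm ⟨b, hb⟩).2)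
  simpa using this

theorem right_le_of_oplusThree_le (h : oplusThree ν ξ ≤ Y) (hA : A ≤ Y) (hB : B ≤ Y) :
    C ≤ Y := fun c hc => by
  have := sub_mem (sub_mem (oplusThree_le_iff.1 h (ξ.symm ⟨c, hc⟩)) (hB (ν (ξ.symm ⟨c, hc⟩)).2))
    (hA (ξ.symm ⟨c, hc⟩).2)
  simp only [add_sub_right_comm, LinearEquiv.apply_symm_apply] at this
  simpa using this

end Oplus

/-! ### The cover given by a decomposition -/

namespace CacheDecomposition

variable {𝕜 U : Type*} [Field 𝕜] [AddCommGroup U] [Module 𝕜 U] {W : Fin 3 → Submodule 𝕜 U}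
  {Z : Submodule 𝕜 U} (D : CacheDecomposition W Z)

/-- The sum of all parts of the document `W i`. -/
def document (i : Fin 3) : Submodule 𝕜 U := ⨆ k, D.part i k

/-- The sum of the parts of the document `W i` outside the triple-sum scheme. -/
def lower (i : Fin 3) : Submodule 𝕜 U := D.part i 0 ⊔ D.part i 1 ⊔ D.part i 2 ⊔ D.part i 3

/-- The sum of all parts outside the triple-sum scheme, and of the triple-sum part of the cache. -/
def hull : Submodule 𝕜 U :=
  D.lower 0 ⊔ D.lower 1 ⊔ D.lower 2 ⊔ oplusThree D.tripleAB D.tripleAC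

theorem part_le_document (i k) : D.part i k ≤ D.document i := le_iSup (D.part i) k

theorem document_le (i) : D.document i ≤ W i := iSup_le (D.part_le i)

theorem lower_le_document (i) : D.lower i ≤ D.document i :=
  sup_le (sup_le (sup_le (D.part_le_document i 0) (D.part_le_document i 1))
    (D.part_le_document i 2)) (D.part_le_document i 3)

theorem disjoint_lower (i) : Disjoint (D.lower i) (D.part i 4) := by
  refine ((iSupIndep_def.1 (D.indep i) 4).mono_right ?_).symm
  refine sup_le (sup_le (sup_le ?_ ?_) ?_) ?_
  · exact le_iSup₂_of_le 0 (by decide) le_rfl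
  · exact le_iSup₂_of_le 1 (by decide) le_rfl
  · exact le_iSup₂_of_le 2 (by decide) le_rfl
  · exact le_iSup₂_of_le 3 (by decide) le_rfl

theorem span_le_iff {Y : Submodule 𝕜 U} : Z ≤ Y ↔
    (D.part 0 0 ≤ Y ∧ D.part 1 0 ≤ Y ∧ D.part 2 0 ≤ Y) ∧
      (oplusTwo D.tianAB ≤ Y ∧ oplusTwo D.tianBC ≤ Y) ∧
      (oplusTwo D.pairAB ≤ Y ∧ oplusTwo D.pairAC ≤ Y ∧ oplusTwo D.pairBC ≤ Y) ∧
      oplusThree D.tripleAB D.tripleAC ≤ Y := by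
  conv_lhs => rw [D.span_eq]
  simp only [sup_le_iff, and_assoc]

theorem le_hull : Z ≤ D.hull := by
  have hl : ∀ i, D.lower i ≤ D.hull := fun i => by
    fin_cases i
    · exact (le_sup_left.trans le_sup_left).trans le_sup_left
    · exact (le_sup_right.trans le_sup_left).trans le_sup_left
    · exact le_sup_right.trans le_sup_left
  have h0 : ∀ i, D.part i 0 ≤ D.hull := fun i =>
    ((le_sup_left.trans le_sup_left).trans le_sup_left).trans (hl i)
  have h1 : ∀ i, D.part i 1 ≤ D.hull := fun i =>
    ((le_sup_right.trans le_sup_left).trans le_sup_left).trans (hl i)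
  have h2 : ∀ i, D.part i 2 ≤ D.hull := fun i =>
    (le_sup_right.trans le_sup_left).trans (hl i)
  have h3 : ∀ i, D.part i 3 ≤ D.hull := fun i => le_sup_right.trans (hl i)
  exact D.span_le_iff.2 ⟨⟨h0 0, h0 1, h0 2⟩,
    ⟨oplusTwo_le_sup.trans (sup_le (h1 0) (h1 1)), oplusTwo_le_sup.trans (sup_le (h1 1) (h1 2))⟩,
    ⟨oplusTwo_le_sup.trans (sup_le (h2 0) (h2 1)), oplusTwo_le_sup.trans (sup_le (h3 0) (h2 2)),
      oplusTwo_le_sup.trans (sup_le (h3 1) (h3 2))⟩, le_sup_right⟩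

theorem le_iSup_document : Z ≤ ⨆ i, D.document i := by
  have h : ∀ i k, D.part i k ≤ ⨆ i, D.document i := fun i k =>
    (D.part_le_document i k).trans (le_iSup D.document i)
  have hl : ∀ i, D.lower i ≤ ⨆ i, D.document i := fun i =>
    (D.lower_le_document i).trans (le_iSup D.document i)
  exact D.le_hull.trans (sup_le (sup_le (sup_le (hl 0) (hl 1)) (hl 2))
    (oplusThree_le_sup.trans (sup_le (sup_le (h 0 4) (h 1 4)) (h 2 4))))

/-- Let `l` be the third document. The `l`-component of the cache vector must vanish, hence so does
its triple-sum term, as that part is disjoint from the lower ones. The vector is then the lower part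
of the `k`-component: a triple sum reveals nothing to a user who knows only one document. -/
theorem inf_le_hull (hW : iSupIndep W) {i k : Fin 3} (hik : i ≠ k) :
    (W i ⊔ Z) ⊓ W k ≤ D.hull := by
  obtain ⟨l, hil, hkl⟩ : ∃ l, i ≠ l ∧ k ≠ l := by
    revert i k
    decide
  rintro x ⟨hx, hxk⟩
  obtain ⟨π, hπ⟩ := hW.exists_projectionFamily
  obtain ⟨w, hw, z, hz, rfl⟩ := Submodule.mem_sup.1 hx
  obtain ⟨y, hy, t, ht, rfl⟩ := Submodule.mem_sup.1 (D.le_hull hz)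
  obtain ⟨a, rfl⟩ := ht
  obtain ⟨y', hy', y₂, hy₂, rfl⟩ := Submodule.mem_sup.1 hy
  obtain ⟨y₀, hy₀, y₁, hy₁, rfl⟩ := Submodule.mem_sup.1 hy'
  set y : Fin 3 → U := ![y₀, y₁, y₂] with hyd
  set t : Fin 3 → U := ![a, D.tripleAB a, D.tripleAC a] with htd
  have hyl : ∀ m, y m ∈ D.lower m := fun m => by fin_cases m <;> assumption
  have htl : ∀ m, t m ∈ D.part m 4 := fun m => by
    fin_cases m
    · exact a.2
    · exact (D.tripleAB a).2
    · exact (D.tripleAC a).2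
  have hyW : ∀ m, y m ∈ W m := fun m =>
    D.document_le m (D.lower_le_document m (hyl m))
  have htW : ∀ m, t m ∈ W m := fun m => D.part_le m 4 (htl m)
  have hz' : y₀ + y₁ + y₂ + (((D.part 0 4).subtype +
      (D.part 1 4).subtype ∘ₗ D.tripleAB.toLinearMap +
      (D.part 2 4).subtype ∘ₗ D.tripleAC.toLinearMap) a) = ∑ m, (y m + t m) := by
    simp [Fin.sum_univ_three, hyd, htd]
    abel
  rw [hz'] at hz hxk ⊢
  have hp : ∀ m, π m (∑ m, (y m + t m)) = y m + t m := fun m => by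
    rw [map_sum, Finset.sum_eq_single m]
    · exact hπ.apply_self _ _ (add_mem (hyW m) (htW m))
    · exact fun b _ hb => hπ.apply_other _ _ hb.symm _ (add_mem (hyW b) (htW b))
    · simp
  have hl := hπ.apply_other l k hkl.symm _ hxk
  rw [map_add, hp, hπ.apply_other l i hil.symm _ hw, zero_add] at hl
  have htl0 : t l = 0 := by
    refine Submodule.disjoint_def.1 (D.disjoint_lower l) _ ?_ (htl l)
    rw [← neg_eq_of_add_eq_zero_right hl]
    exact neg_mem (hyl l)
  have ha : a = 0 := by
    clear_value y
    fin_cases l <;> simpa [htd] using htl0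
  have htk : t k = 0 := by
    fin_cases k <;> simp [htd, ha]
  have hk := hπ.apply_self k _ hxk
  rw [map_add, hp, hπ.apply_other k i hik.symm _ hw, zero_add, htk, add_zero] at hk
  rw [← hk]
  have hlh : D.lower k ≤ D.hull := by
    fin_cases k
    · exact (le_sup_left.trans le_sup_left).trans le_sup_left
    · exact (le_sup_right.trans le_sup_left).trans le_sup_left
    · exact le_sup_right.trans le_sup_left
  exact hlh (hyl k)

theorem cacheCover (hW : iSupIndep W) : CacheCover W Z D.document D.hull where
  le_iSup := D.le_iSup_document
  le_document := D.document_le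
  le_hull := D.le_hull
  inf_le_hull _ _ hik := D.inf_le_hull hW hik

theorem finrank_tripleAB : Module.finrank 𝕜 (D.part 1 4) = Module.finrank 𝕜 (D.part 0 4) :=
  D.tripleAB.finrank_eq.symm

theorem finrank_tripleAC : Module.finrank 𝕜 (D.part 2 4) = Module.finrank 𝕜 (D.part 0 4) :=
  D.tripleAC.finrank_eq.symm

section Finrank

variable [FiniteDimensional 𝕜 U]

theorem finrank_document (i) :
    Module.finrank 𝕜 (D.document i) = ∑ k, Module.finrank 𝕜 (D.part i k) :=
  (D.indep i).finrank_iSup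

/-- The hull keeps one diagonal copy in place of the three triple-sum parts. -/
theorem finrank_hull_add_le : Module.finrank 𝕜 D.hull + 2 * Module.finrank 𝕜 (D.part 0 4) ≤
    ∑ i, Module.finrank 𝕜 (D.document i) := by
  have hl : ∀ i, Module.finrank 𝕜 (D.lower i) + Module.finrank 𝕜 (D.part i 4) ≤
      Module.finrank 𝕜 (D.document i) := fun i => by
    have e := Submodule.finrank_sup_add_finrank_inf_eq (D.lower i) (D.part i 4)
    rw [(D.disjoint_lower i).eq_bot, finrank_bot] at e
    rw [← e, add_zero]
    exact Submodule.finrank_mono (sup_le (D.lower_le_document i) (D.part_le_document i 4))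
  have h0 := hl 0
  have h1 := hl 1
  have h2 := hl 2
  rw [finrank_tripleAB] at h1
  rw [finrank_tripleAC] at h2
  have e1 := Submodule.finrank_add_le_finrank_add_finrank
    (D.lower 0 ⊔ D.lower 1 ⊔ D.lower 2) (oplusThree D.tripleAB D.tripleAC)
  have e2 := Submodule.finrank_add_le_finrank_add_finrank (D.lower 0 ⊔ D.lower 1) (D.lower 2)
  have e3 := Submodule.finrank_add_le_finrank_add_finrank (D.lower 0) (D.lower 1)
  have e4 := finrank_oplusThree_le (ν := D.tripleAB) (ξ := D.tripleAC)
  rw [Fin.sum_univ_three, hull]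
  omega

end Finrank

end CacheDecomposition

/-! ### Parts inside cells, and intersections of caches with documents -/

theorem mem_of_add_mem_iSup {𝕜 U : Type*} [Field 𝕜] [AddCommGroup U] [Module 𝕜 U]
    {W P : Fin 3 → Submodule 𝕜 U} (hW : iSupIndep W) (hP : ∀ i, P i ≤ W i) {x : Fin 3 → U}
    (hx : ∀ i, x i ∈ W i) (h : ∑ i, x i ∈ ⨆ i, P i) (i : Fin 3) : x i ∈ P i := by
  obtain ⟨π, hπ⟩ := hW.exists_projectionFamily
  have hp : π i (∑ m, x m) = x i := by
    rw [map_sum, Finset.sum_eq_single i]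
    · exact hπ.apply_self _ _ (hx i)
    · exact fun b _ hb => hπ.apply_other _ _ hb.symm _ (hx b)
    · simp
  rw [← hp]
  have hle : ⨆ i, P i ≤ (P i).comap (π i) := iSup_le fun m y hy => by
    rw [Submodule.mem_comap]
    by_cases hm : i = m
    · subst hm
      rwa [hπ.apply_self _ _ (hP _ hy)]
    · rw [hπ.apply_other _ _ hm _ (hP _ hy)]
      exact zero_mem _
  exact hle h

namespace CacheDecomposition

variable {𝕜 U : Type*} [Field 𝕜] [AddCommGroup U] [Module 𝕜 U] {W : Fin 3 → Submodule 𝕜 U}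
  {Z : Submodule 𝕜 U} (D : CacheDecomposition W Z)

theorem oplusTwo_le_iSup {P : Fin 3 → Submodule 𝕜 U} (hW : iSupIndep W) (hP : ∀ i, P i ≤ W i)
    {i k : Fin 3} (hik : i ≠ k) {A B : Submodule 𝕜 U} {ν : A ≃ₗ[𝕜] B} (hA : A ≤ W i)
    (hB : B ≤ W k) (h : oplusTwo ν ≤ ⨆ i, P i) : A ≤ P i ∧ B ≤ P k := by
  have key : ∀ a : A, (a : U) ∈ P i ∧ (ν a : U) ∈ P k := fun a => by
    have hs : ∑ m, (Pi.single i (a : U) + Pi.single k (ν a : U) : Fin 3 → U) m = a + ν a := by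
      simp [Finset.sum_add_distrib]
    have hm := mem_of_add_mem_iSup hW hP
      (x := Pi.single i (a : U) + Pi.single k (ν a : U)) (fun m => ?_)
      (hs ▸ oplusTwo_le_iff.1 h a)
    · have hi := hm i
      have hk := hm k
      simp only [Pi.add_apply, Pi.single_eq_same, Pi.single_eq_of_ne hik,
        Pi.single_eq_of_ne hik.symm, add_zero, zero_add] at hi hk
      exact ⟨hi, hk⟩
    · refine add_mem ?_ ?_
      · by_cases hm : m = i
        · subst hm
          simpa using hA a.2
        · simp [Pi.single_eq_of_ne hm]
      · by_cases hm : m = k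
        · subst hm
          simpa using hB (ν a).2
        · simp [Pi.single_eq_of_ne hm]
  exact ⟨fun a ha => (key ⟨a, ha⟩).1, fun b hb => by simpa using (key (ν.symm ⟨b, hb⟩)).2⟩

/-- Every vector of a part is the `W i`-component of a cache vector. With `P` a column of the grid,
this places the parts of each user in that user's own cells. -/
theorem document_le_of_le_iSup {P : Fin 3 → Submodule 𝕜 U} (hW : iSupIndep W)
    (hP : ∀ i, P i ≤ W i) (hZ : Z ≤ ⨆ i, P i) (i : Fin 3) : D.document i ≤ P i := by
  obtain ⟨⟨a0, b0, c0⟩, ⟨ab1, bc1⟩, ⟨ab2, ac3, bc3⟩, t4⟩ := D.span_le_iff.1 hZ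
  have hd : ∀ i k, D.part i k ≤ ⨆ i, P i → D.part i k ≤ P i := fun i k h x hx => by
    have := mem_of_add_mem_iSup hW hP (x := Pi.single i x) (fun m => ?_)
      (by simpa using h hx) i
    · simpa using this
    · by_cases hm : m = i
      · subst hm
        simpa using D.part_le _ _ hx
      · simp [Pi.single_eq_of_ne hm]
  obtain ⟨a1, b1⟩ := oplusTwo_le_iSup hW hP (i := 0) (k := 1) (by decide) (D.part_le 0 1)
    (D.part_le 1 1) ab1
  obtain ⟨-, c1⟩ := oplusTwo_le_iSup hW hP (i := 1) (k := 2) (by decide) (D.part_le 1 1)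
    (D.part_le 2 1) bc1
  obtain ⟨a2, b2⟩ := oplusTwo_le_iSup hW hP (i := 0) (k := 1) (by decide) (D.part_le 0 2)
    (D.part_le 1 2) ab2
  obtain ⟨a3, c2⟩ := oplusTwo_le_iSup hW hP (i := 0) (k := 2) (by decide) (D.part_le 0 3)
    (D.part_le 2 2) ac3
  obtain ⟨b3, c3⟩ := oplusTwo_le_iSup hW hP (i := 1) (k := 2) (by decide) (D.part_le 1 3)
    (D.part_le 2 3) bc3
  have ht : ∀ a : D.part 0 4, ∀ m,
      (![(a : U), D.tripleAB a, D.tripleAC a] : Fin 3 → U) m ∈ P m := fun a =>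
    mem_of_add_mem_iSup hW hP (fun m => by
      fin_cases m
      · exact D.part_le 0 4 a.2
      · exact D.part_le 1 4 (D.tripleAB a).2
      · exact D.part_le 2 4 (D.tripleAC a).2)
      (by simpa [Fin.sum_univ_three] using oplusThree_le_iff.1 t4 a)
  refine iSup_le fun k => ?_
  fin_cases i <;> fin_cases k
  · exact hd _ _ a0
  · exact a1
  · exact a2
  · exact a3
  · exact fun a ha => ht ⟨a, ha⟩ 0
  · exact hd _ _ b0
  · exact b1
  · exact b2
  · exact b3
  · exact fun b hb => by simpa using ht (D.tripleAB.symm ⟨b, hb⟩) 1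
  · exact hd _ _ c0
  · exact c1
  · exact c2
  · exact c3
  · exact fun c hc => by simpa using ht (D.tripleAC.symm ⟨c, hc⟩) 2

/-- Bounds `Z ⊓ W i` from above: if knowing `W i`, `Z` and the small spaces `E`, `E'` reveals all
parts of the other two documents, then `Z` must be large modulo `W i`. -/
theorem finrank_document_add_le [FiniteDimensional 𝕜 U] (hW : iSupIndep W) {i l m : Fin 3}
    (hil : i ≠ l) (him : i ≠ m) (hlm : l ≠ m) {E E' : Submodule 𝕜 U}
    (hl : D.document l ≤ W i ⊔ Z ⊔ (E ⊔ E')) (hm : D.document m ≤ W i ⊔ Z ⊔ (E ⊔ E')) :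
    Module.finrank 𝕜 (D.document l) + Module.finrank 𝕜 (D.document m) +
        Module.finrank 𝕜 ↥(Z ⊓ W i) ≤
      Module.finrank 𝕜 Z + Module.finrank 𝕜 E + Module.finrank 𝕜 E' := by
  have hd : Disjoint (D.document l) (D.document m) :=
    (hW.pairwiseDisjoint hlm).mono (D.document_le l) (D.document_le m)
  have hd' : Disjoint (W i) (D.document l ⊔ D.document m) := by
    refine (iSupIndep_def.1 hW i).mono_right (sup_le ?_ ?_)
    · exact (D.document_le l).trans (le_iSup₂_of_le l hil.symm le_rfl)
    · exact (D.document_le m).trans (le_iSup₂_of_le m him.symm le_rfl)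
  have e := finrank_sup_three_of_disjoint hd hd'
  have e1 := Submodule.finrank_mono
    (sup_le (le_sup_left.trans le_sup_left) (sup_le hl hm) :
      W i ⊔ (D.document l ⊔ D.document m) ≤ W i ⊔ Z ⊔ (E ⊔ E'))
  have e2 := Submodule.finrank_add_le_finrank_add_finrank (W i ⊔ Z) (E ⊔ E')
  have e3 := Submodule.finrank_add_le_finrank_add_finrank E E'
  have e4 := Submodule.finrank_sup_add_finrank_inf_eq (W i) Z
  rw [inf_comm (W i) Z] at e4
  omega

theorem document_le_iff {Y : Submodule 𝕜 U} {i : Fin 3} : D.document i ≤ Y ↔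
    D.part i 0 ≤ Y ∧ D.part i 1 ≤ Y ∧ D.part i 2 ≤ Y ∧ D.part i 3 ≤ Y ∧ D.part i 4 ≤ Y := by
  simp [document, iSup_le_iff, Fin.forall_fin_succ]

variable [FiniteDimensional 𝕜 U]

/-- Knowing one document resolves the individual and Tian parts and two of the two-way schemes. One
summand of the remaining two-way scheme and one of the triple sum must be supplied. -/
theorem finrank_inf_add_le_zero (hW : iSupIndep W) :
    Module.finrank 𝕜 (D.document 1) + Module.finrank 𝕜 (D.document 2) +
        Module.finrank 𝕜 ↥(Z ⊓ W 0) ≤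
      Module.finrank 𝕜 Z + Module.finrank 𝕜 (D.part 1 3) + Module.finrank 𝕜 (D.part 1 4) := by
  set Y := W 0 ⊔ Z ⊔ (D.part 1 3 ⊔ D.part 1 4) with hY
  have hW0 : ∀ k, D.part 0 k ≤ Y := fun k =>
    (D.part_le 0 k).trans (le_sup_left.trans le_sup_left)
  obtain ⟨⟨a0, b0, c0⟩, ⟨ab1, bc1⟩, ⟨ab2, ac3, bc3⟩, t4⟩ :=
    D.span_le_iff.1 (le_sup_right.trans le_sup_left : Z ≤ Y)
  have b1 := right_le_of_oplusTwo_le ab1 (hW0 1)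
  have b3 : D.part 1 3 ≤ Y := le_sup_left.trans le_sup_right
  have b4 : D.part 1 4 ≤ Y := le_sup_right.trans le_sup_right
  refine D.finrank_document_add_le hW (by decide) (by decide) (by decide)
    (D.document_le_iff.2 ⟨b0, b1, right_le_of_oplusTwo_le ab2 (hW0 2), b3, b4⟩)
    (D.document_le_iff.2 ⟨c0, right_le_of_oplusTwo_le bc1 b1, right_le_of_oplusTwo_le ac3 (hW0 3),
      right_le_of_oplusTwo_le bc3 b3, right_le_of_oplusThree_le t4 (hW0 4) b4⟩)

theorem finrank_inf_add_le_one (hW : iSupIndep W) :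
    Module.finrank 𝕜 (D.document 0) + Module.finrank 𝕜 (D.document 2) +
        Module.finrank 𝕜 ↥(Z ⊓ W 1) ≤
      Module.finrank 𝕜 Z + Module.finrank 𝕜 (D.part 0 3) + Module.finrank 𝕜 (D.part 0 4) := by
  set Y := W 1 ⊔ Z ⊔ (D.part 0 3 ⊔ D.part 0 4) with hY
  have hW1 : ∀ k, D.part 1 k ≤ Y := fun k =>
    (D.part_le 1 k).trans (le_sup_left.trans le_sup_left)
  obtain ⟨⟨a0, b0, c0⟩, ⟨ab1, bc1⟩, ⟨ab2, ac3, bc3⟩, t4⟩ :=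
    D.span_le_iff.1 (le_sup_right.trans le_sup_left : Z ≤ Y)
  have a3 : D.part 0 3 ≤ Y := le_sup_left.trans le_sup_right
  have a4 : D.part 0 4 ≤ Y := le_sup_right.trans le_sup_right
  refine D.finrank_document_add_le hW (by decide) (by decide) (by decide)
    (D.document_le_iff.2 ⟨a0, left_le_of_oplusTwo_le ab1 (hW1 1),
      left_le_of_oplusTwo_le ab2 (hW1 2), a3, a4⟩)
    (D.document_le_iff.2 ⟨c0, right_le_of_oplusTwo_le bc1 (hW1 1), right_le_of_oplusTwo_le ac3 a3,
      right_le_of_oplusTwo_le bc3 (hW1 3), right_le_of_oplusThree_le t4 a4 (hW1 4)⟩)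

theorem finrank_inf_add_le_two (hW : iSupIndep W) :
    Module.finrank 𝕜 (D.document 0) + Module.finrank 𝕜 (D.document 1) +
        Module.finrank 𝕜 ↥(Z ⊓ W 2) ≤
      Module.finrank 𝕜 Z + Module.finrank 𝕜 (D.part 0 2) + Module.finrank 𝕜 (D.part 0 4) := by
  set Y := W 2 ⊔ Z ⊔ (D.part 0 2 ⊔ D.part 0 4) with hY
  have hW2 : ∀ k, D.part 2 k ≤ Y := fun k =>
    (D.part_le 2 k).trans (le_sup_left.trans le_sup_left)
  obtain ⟨⟨a0, b0, c0⟩, ⟨ab1, bc1⟩, ⟨ab2, ac3, bc3⟩, t4⟩ :=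
    D.span_le_iff.1 (le_sup_right.trans le_sup_left : Z ≤ Y)
  have b1 := left_le_of_oplusTwo_le bc1 (hW2 1)
  have a2 : D.part 0 2 ≤ Y := le_sup_left.trans le_sup_right
  have a4 : D.part 0 4 ≤ Y := le_sup_right.trans le_sup_right
  refine D.finrank_document_add_le hW (by decide) (by decide) (by decide)
    (D.document_le_iff.2 ⟨a0, left_le_of_oplusTwo_le ab1 b1, a2,
      left_le_of_oplusTwo_le ac3 (hW2 2), a4⟩)
    (D.document_le_iff.2 ⟨b0, b1, right_le_of_oplusTwo_le ab2 a2,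
      left_le_of_oplusTwo_le bc3 (hW2 3), middle_le_of_oplusThree_le t4 a4 (hW2 4)⟩)

end CacheDecomposition

/-! ### The inequalities with ratios -/

namespace LinearCachingScheme

variable {𝕜 U : Type*} [Field 𝕜] [AddCommGroup U] [Module 𝕜 U] [FiniteDimensional 𝕜 U] {F : ℕ}
  {S : LinearCachingScheme 𝕜 U 3 3 F} {M R r₁ r₂ r₃ r₄ r₅ : ℝ}

theorem HasRatios.bounds (h : S.HasRatios r₁ r₂ r₃ r₄ r₅) (hF : 0 < F) (hMR : S.Achieves M R)
    (hS : S.IsSeparated) :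
    2 * R + 3 * M ≥ 5 - 3 / 2 * r₃ + 3 * r₅ ∧ 6 * M + 5 * R ≥ 11 + 3 * r₄ + 15 / 2 * r₅ := by
  obtain ⟨D, hD, h5⟩ := h
  obtain ⟨P, hPi, hPW, -, hZ⟩ := id hS
  have hF' : (0 : ℝ) < F := by exact_mod_cast hF
  have hC := fun j => (D j).cacheCover S.indep_W
  have h1 := hMR.pairwise_bound hS (Q := fun i j => (D j).document i) hC
  have h2 := hMR.combined_bound hS (Q := fun i j => (D j).document i) hC
  have hdoc : ∀ i j, (Module.finrank 𝕜 ((D j).document i) : ℝ) = F * (r₁ + r₂ + r₃ + r₄) := by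
    intro i j
    obtain ⟨d0, d1, d2, d3, d4⟩ := hD j i
    rw [(D j).finrank_document i]
    simp only [Fin.sum_univ_five, Nat.cast_add, d0, d1, d2, d3, d4]
    ring
  have hhull : ∀ j, (Module.finrank 𝕜 (D j).hull : ℝ) ≤
      3 * (F * (r₁ + r₂ + r₃ + r₄)) - 2 * (F * r₄) := by
    intro j
    have e : (Module.finrank 𝕜 (D j).hull : ℝ) + 2 * Module.finrank 𝕜 ((D j).part 0 4) ≤
        ∑ i, (Module.finrank 𝕜 ((D j).document i) : ℝ) := by
      exact_mod_cast (D j).finrank_hull_add_le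
    simp only [hdoc, (hD j 0).2.2.2.2, Fin.sum_univ_three] at e
    linarith
  have hinf : ∀ i j, (Module.finrank 𝕜 ↥(S.Z j ⊓ S.W i) : ℝ) ≤
      M * F - 2 * (F * (r₁ + r₂ + r₃ + r₄)) + F * (r₃ / 2) + F * r₄ := by
    intro i j
    have hM := hMR.1 j
    have key : ∃ l m n : Fin 3, (Module.finrank 𝕜 ((D j).document l) : ℝ) +
        Module.finrank 𝕜 ((D j).document m) + Module.finrank 𝕜 ↥(S.Z j ⊓ S.W i) ≤
        Module.finrank 𝕜 (S.Z j) + F * (r₃ / 2) + Module.finrank 𝕜 ((D j).part n 4) := by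
      fin_cases i
      · refine ⟨1, 2, 1, ?_⟩
        rw [← (hD j 1).2.2.2.1]
        exact_mod_cast (D j).finrank_inf_add_le_zero S.indep_W
      · refine ⟨0, 2, 0, ?_⟩
        rw [← (hD j 0).2.2.2.1]
        exact_mod_cast (D j).finrank_inf_add_le_one S.indep_W
      · refine ⟨0, 1, 0, ?_⟩
        rw [← (hD j 0).2.2.1]
        exact_mod_cast (D j).finrank_inf_add_le_two S.indep_W
    obtain ⟨l, m, n, key⟩ := key
    rw [hdoc, hdoc, (hD j n).2.2.2.2] at key
    linarith
  -- Different users have their parts in different cells, so the dimensions add up; hence `r₁ + r₂ +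
  -- r₃ + r₄ = 1/3 - r₅`.
  have hsup : (Module.finrank 𝕜 ↥(⨆ j, ⨆ k, (D j).part 0 k) : ℝ) =
      3 * (F * (r₁ + r₂ + r₃ + r₄)) := by
    have hind : iSupIndep fun j => (D j).document 0 := (hPi 0).mono fun j =>
      (D j).document_le_of_le_iSup S.indep_W (P := fun i => P i j)
        (fun i => hPW i ▸ le_iSup (P i) j) (hZ j) 0
    have e := congrArg (Nat.cast : ℕ → ℝ) hind.finrank_iSup
    rw [Nat.cast_sum] at e
    simp only [hdoc, Fin.sum_univ_three] at e
    refine Eq.trans ?_ (e.trans (by ring))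
    rfl
  have hle : (Module.finrank 𝕜 ↥(⨆ j, ⨆ k, (D j).part 0 k) : ℝ) ≤ F := by
    have := Submodule.finrank_mono (iSup_le fun j => iSup_le fun k => (D j).part_le 0 k :
      ⨆ j, ⨆ k, (D j).part 0 k ≤ S.W 0)
    rw [S.finrank_W] at this
    exact_mod_cast this
  -- The count gives `12 r₅` in the second inequality; the sign of `r₅` is needed to pass to `15/2`.
  have hr5 : 0 ≤ F * r₅ := by linarith
  have s1 := Finset.sum_le_sum fun (i : Fin 3) (_ : i ∈ Finset.univ) =>
    Finset.sum_le_sum fun (j : Fin 3) (_ : j ∈ Finset.univ) => hinf i j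
  have s2 := Finset.sum_le_sum fun (j : Fin 3) (_ : j ∈ Finset.univ) => hhull j
  simp only [hdoc, Finset.sum_const, Finset.card_univ, Fintype.card_fin, nsmul_eq_mul] at h1 h2 s1 s2
  push_cast at h1 h2 s1 s2
  rw [hsup] at h5
  constructor
  · have : (5 - 3 / 2 * r₃ + 3 * r₅ - (2 * R + 3 * M)) * F ≤ 0 := by linarith
    nlinarith
  · have : (11 + 3 * r₄ + 15 / 2 * r₅ - (6 * M + 5 * R)) * F ≤ 0 := by linarith
    nlinarith

end LinearCachingScheme

/-! ### Reaches, complements and independence -/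

section Construction

variable {𝕜 U : Type*} [Field 𝕜] [AddCommGroup U] [Module 𝕜 U]

theorem exists_disjoint_sup_eq {a b : Submodule 𝕜 U} (h : a ≤ b) :
    ∃ c, Disjoint c a ∧ a ⊔ c = b := by
  obtain ⟨c, hc⟩ := exists_isCompl a
  refine ⟨c ⊓ b, hc.disjoint.symm.mono_left inf_le_left, ?_⟩
  rw [← sup_inf_assoc_of_le c h, hc.sup_eq_top, top_inf_eq]

theorem finrank_add_of_disjoint_sup_eq [FiniteDimensional 𝕜 U] {a b c : Submodule 𝕜 U}
    (hd : Disjoint c a) (h : a ⊔ c = b) :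
    Module.finrank 𝕜 c + Module.finrank 𝕜 a = Module.finrank 𝕜 b := by
  have e := Submodule.finrank_sup_add_finrank_inf_eq a c
  rw [h, hd.symm.eq_bot, finrank_bot] at e
  omega

/-- The vectors of `A` that become elements of `Z` after adding some vector of `B`. -/
def reach (Z A B : Submodule 𝕜 U) : Submodule 𝕜 U := A ⊓ (Z ⊔ B)

theorem mem_reach {Z A B : Submodule 𝕜 U} {x : U} :
    x ∈ reach Z A B ↔ x ∈ A ∧ ∃ y ∈ B, x + y ∈ Z := by
  refine and_congr_right fun _ => ⟨fun h => ?_, ?_⟩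
  · obtain ⟨z, hz, y, hy, rfl⟩ := Submodule.mem_sup.1 h
    exact ⟨-y, neg_mem hy, by simpa using hz⟩
  · rintro ⟨y, hy, h⟩
    have := Submodule.add_mem_sup h (neg_mem hy)
    simpa using this

theorem inf_le_reach {Z A B : Submodule 𝕜 U} : Z ⊓ A ≤ reach Z A B :=
  le_inf inf_le_right (inf_le_left.trans le_sup_left)

/-- Partners in `V` can be chosen linearly because `S` is projective. The choice is injective: a
vector with partner `0` lies in `S ⊓ Z`. -/
theorem exists_equiv_add_mem {Z S V : Submodule 𝕜 U} (h : S ≤ Z ⊔ V) (hd : Disjoint S Z) :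
    ∃ T ≤ V, ∃ ν : S ≃ₗ[𝕜] T, ∀ s : S, (s : U) + ν s ∈ Z := by
  have hmem : ∀ s : S, Z.mkQ (-(s : U)) ∈ LinearMap.range (Z.mkQ ∘ₗ V.subtype) := fun s => by
    obtain ⟨z, hz, v, hv, e⟩ := Submodule.mem_sup.1 (h s.2)
    refine ⟨⟨-v, neg_mem hv⟩, ?_⟩
    have : v - (s : U) ∈ Z := by
      rw [← e]
      simpa using neg_mem hz
    simp only [LinearMap.comp_apply, Submodule.subtype_apply, Submodule.mkQ_apply]
    rw [Submodule.Quotient.eq]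
    rw [← neg_mem_iff]
    convert this using 1
    abel
  obtain ⟨f, hf⟩ := Module.projective_lifting_property
    (LinearMap.rangeRestrict (Z.mkQ ∘ₗ V.subtype))
    (LinearMap.codRestrict _ (-(Z.mkQ ∘ₗ S.subtype)) fun s => by simpa using hmem s)
    (LinearMap.surjective_rangeRestrict _)
  have hf' : ∀ s : S, (s : U) + f s ∈ Z := fun s => by
    have e : Z.mkQ (f s) = -Z.mkQ s := congrArg Subtype.val (LinearMap.congr_fun hf s)
    rw [← Submodule.ker_mkQ Z, LinearMap.mem_ker, map_add, e, add_neg_cancel]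
  have hinj : Function.Injective (V.subtype ∘ₗ f) := by
    rw [injective_iff_map_eq_zero]
    intro s hs
    have h0 := hf' s
    rw [show ((f s : V) : U) = 0 from hs, add_zero] at h0
    exact Subtype.ext (Submodule.disjoint_def.1 hd _ s.2 h0)
  refine ⟨LinearMap.range (V.subtype ∘ₗ f), ?_, LinearEquiv.ofInjective _ hinj, hf'⟩
  rintro _ ⟨s, rfl⟩
  exact (f s).2

theorem iSupIndep_of_sum_eq_zero {ι : Type*} [Fintype ι] {p : ι → Submodule 𝕜 U}
    (h : ∀ v : ι → U, (∀ i, v i ∈ p i) → ∑ i, v i = 0 → ∀ i, v i = 0) : iSupIndep p := by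
  classical
  rw [iSupIndep_iff_finsetSum_eq_zero_imp_eq_zero]
  intro s v hv hs i hi
  have := h (fun i => if i ∈ s then v i else 0) (fun i => ?_) (by simpa using hs) i
  · simpa [hi] using this
  · by_cases hi : i ∈ s
    · simpa [hi] using hv i hi
    · simp [hi]

/-- Used with `E₁`, `E₂` the reaches of one document into the other two. In a vanishing sum the
terms are peeled off from the last to the first. -/
theorem iSupIndep_five {p : Fin 5 → Submodule 𝕜 U} {E₁ E₂ : Submodule 𝕜 U}
    (h₀₁ : Disjoint (p 1) (p 0)) (h₀ : p 0 ≤ E₁ ⊓ E₂) (h₁ : p 1 ≤ E₁ ⊓ E₂) (h₂ : p 2 ≤ E₁)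
    (h₃ : p 3 ≤ E₂) (h₂' : Disjoint (p 2) E₂) (h₃' : Disjoint (p 3) E₁)
    (h₄ : Disjoint (p 4) (E₁ ⊔ E₂)) : iSupIndep p := by
  refine iSupIndep_of_sum_eq_zero fun v hv hs => ?_
  rw [Fin.sum_univ_five] at hs
  have v4 : v 4 = 0 := by
    refine Submodule.disjoint_def.1 h₄ _ (hv 4) ?_
    rw [← neg_eq_of_add_eq_zero_right hs]
    have l : ∀ {q}, q ≤ E₁ → q ≤ E₁ ⊔ E₂ := fun h => h.trans le_sup_left
    exact neg_mem (add_mem (add_mem (add_mem (l (h₀.trans inf_le_left) (hv 0))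
      (l (h₁.trans inf_le_left) (hv 1))) (l h₂ (hv 2))) (le_sup_right (a := E₁) (h₃ (hv 3))))
  rw [v4, add_zero] at hs
  have v3 : v 3 = 0 := by
    refine Submodule.disjoint_def.1 h₃' _ (hv 3) ?_
    rw [← neg_eq_of_add_eq_zero_right hs]
    exact neg_mem (add_mem (add_mem (h₀ (hv 0)).1 (h₁ (hv 1)).1) (h₂ (hv 2)))
  rw [v3, add_zero] at hs
  have v2 : v 2 = 0 := by
    refine Submodule.disjoint_def.1 h₂' _ (hv 2) ?_
    rw [← neg_eq_of_add_eq_zero_right hs]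
    exact neg_mem (add_mem (h₀ (hv 0)).2 (h₁ (hv 1)).2)
  rw [v2, add_zero] at hs
  have v1 : v 1 = 0 := by
    refine Submodule.disjoint_def.1 h₀₁ _ (hv 1) ?_
    rw [← neg_eq_of_add_eq_zero_right hs]
    exact neg_mem (hv 0)
  rw [v1, add_zero] at hs
  intro i
  fin_cases i <;> assumption

/-- The part of `Z` spanned by combinations of two of the three documents. -/
def pairSum (W : Fin 3 → Submodule 𝕜 U) (Z : Submodule 𝕜 U) : Submodule 𝕜 U :=
  Z ⊓ (W 0 ⊔ W 1) ⊔ Z ⊓ (W 0 ⊔ W 2) ⊔ Z ⊓ (W 1 ⊔ W 2)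

variable {W : Fin 3 → Submodule 𝕜 U} {Z : Submodule 𝕜 U}

theorem pairSum_le : pairSum W Z ≤ Z := sup_le (sup_le inf_le_left inf_le_left) inf_le_left

theorem inf_sup_le_pairSum {i k : Fin 3} (hik : i ≠ k) : Z ⊓ (W i ⊔ W k) ≤ pairSum W Z := by
  have h01 : Z ⊓ (W 0 ⊔ W 1) ≤ pairSum W Z := le_sup_left.trans le_sup_left
  have h02 : Z ⊓ (W 0 ⊔ W 2) ≤ pairSum W Z := le_sup_right.trans le_sup_left
  have h12 : Z ⊓ (W 1 ⊔ W 2) ≤ pairSum W Z := le_sup_right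
  fin_cases i <;> fin_cases k <;>
    first
      | exact absurd rfl hik
      | exact h01
      | exact h02
      | exact h12
      | exact sup_comm (W 0) (W 1) ▸ h01
      | exact sup_comm (W 0) (W 2) ▸ h02
      | exact sup_comm (W 1) (W 2) ▸ h12

theorem mem_pairSum_of_apply_eq_zero {π : Fin 3 → U →ₗ[𝕜] U} (hπ : ProjectionFamily W π)
    (hZ : Z ≤ ⨆ i, W i) {i : Fin 3} {z : U} (hz : z ∈ Z) (h : π i z = 0) : z ∈ pairSum W Z := by
  obtain ⟨k, l, hkl, hs⟩ : ∃ k l : Fin 3, k ≠ l ∧ ∀ v : Fin 3 → U, ∑ m, v m = v i + v k + v l := by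
    fin_cases i
    · exact ⟨1, 2, by decide, fun v => by simp [Fin.sum_univ_three]⟩
    · exact ⟨0, 2, by decide, fun v => by simp [Fin.sum_univ_three]; abel⟩
    · exact ⟨0, 1, by decide, fun v => by simp [Fin.sum_univ_three]; abel⟩
  refine inf_sup_le_pairSum hkl ⟨hz, ?_⟩
  rw [← hπ.sum_apply (hZ hz), hs, h, zero_add]
  exact Submodule.add_mem_sup (hπ.mem k z) (hπ.mem l z)

/-- If the `i`-component of `t` is a sum of reachable vectors, subtracting the corresponding
two-document elements of `Z` kills that component. So `t` lies in `pairSum W Z`, hence `t = 0`. -/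
theorem disjoint_range_reach_sup {π : Fin 3 → U →ₗ[𝕜] U} (hπ : ProjectionFamily W π)
    (hZ : Z ≤ ⨆ i, W i) {T : Submodule 𝕜 U} (hTZ : T ≤ Z) (hT : Disjoint T (pairSum W Z))
    {i k l : Fin 3} (hik : i ≠ k) (hil : i ≠ l) :
    Disjoint (LinearMap.range (π i ∘ₗ T.subtype)) (reach Z (W i) (W k) ⊔ reach Z (W i) (W l)) := by
  refine Submodule.disjoint_def.2 ?_
  rintro _ ⟨t, rfl⟩ h
  obtain ⟨r, hr, r', hr', e⟩ := Submodule.mem_sup.1 h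
  obtain ⟨hrW, y, hy, hry⟩ := mem_reach.1 hr
  obtain ⟨hrW', y', hy', hry'⟩ := mem_reach.1 hr'
  have h1 : (t : U) - ((r + y) + (r' + y')) ∈ pairSum W Z := by
    refine mem_pairSum_of_apply_eq_zero hπ hZ (i := i)
      (sub_mem (hTZ t.2) (add_mem hry hry')) ?_
    have e' : π i t = r + r' := e.symm
    simp only [map_sub, map_add]
    rw [e', hπ.apply_self i r hrW, hπ.apply_self i r' hrW', hπ.apply_other i k hik y hy,
      hπ.apply_other i l hil y' hy']
    abel
  have h2 : r + y ∈ pairSum W Z :=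
    inf_sup_le_pairSum hik ⟨hry, Submodule.add_mem_sup hrW hy⟩
  have h3 : r' + y' ∈ pairSum W Z :=
    inf_sup_le_pairSum hil ⟨hry', Submodule.add_mem_sup hrW' hy'⟩
  have h4 : (t : U) ∈ pairSum W Z := by
    simpa using add_mem h1 (add_mem h2 h3)
  have h5 : (t : U) = 0 := Submodule.disjoint_def.1 hT _ t.2 h4
  simp [h5]

end Construction

/-! ### Decomposing an arbitrary cache -/

section Construction

variable {𝕜 U : Type*} [Field 𝕜] [AddCommGroup U] [Module 𝕜 U]

theorem add_sub_add_mem {Z : Submodule 𝕜 U} {x y z : U} (h : x + y ∈ Z) (h' : x + z ∈ Z) :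
    y - z ∈ Z := by
  simpa using sub_mem h h'

/-- If `s + t` and `t + c` lie in `Z`, so does `s - c`: partners reach the same third document. -/
theorem disjoint_target_of_disjoint_source {Z A B C : Submodule 𝕜 U} {S T : Submodule 𝕜 U}
    {ν : S ≃ₗ[𝕜] T} (hν : ∀ s : S, (s : U) + ν s ∈ Z) (hSA : S ≤ A)
    (hd : Disjoint S (reach Z A C)) : Disjoint T (reach Z B C) := by
  refine Submodule.disjoint_def.2 fun x hx h => ?_
  obtain ⟨-, c, hc, hxc⟩ := mem_reach.1 h
  have h1 := hν (ν.symm ⟨x, hx⟩)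
  rw [LinearEquiv.apply_symm_apply, add_comm] at h1
  have h2 : (ν.symm ⟨x, hx⟩ : U) ∈ reach Z A C :=
    mem_reach.2 ⟨hSA (ν.symm ⟨x, hx⟩).2, -c, neg_mem hc, by
      simpa [sub_eq_add_neg] using add_sub_add_mem h1 hxc⟩
  have h3 : ν.symm ⟨x, hx⟩ = 0 :=
    Subtype.ext (Submodule.disjoint_def.1 hd _ (ν.symm ⟨x, hx⟩).2 h2)
  rw [LinearEquiv.map_eq_zero_iff] at h3
  exact congrArg Subtype.val h3

theorem disjoint_target_of_disjoint {Z S T : Submodule 𝕜 U}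
    {ν : S ≃ₗ[𝕜] T} (hν : ∀ s : S, (s : U) + ν s ∈ Z) (hd : Disjoint S Z) : Disjoint T Z := by
  refine Submodule.disjoint_def.2 fun x hx h => ?_
  have h1 := hν (ν.symm ⟨x, hx⟩)
  rw [LinearEquiv.apply_symm_apply] at h1
  have h3 : ν.symm ⟨x, hx⟩ = 0 := Subtype.ext (Submodule.disjoint_def.1 hd _
    (ν.symm ⟨x, hx⟩).2 (by simpa using sub_mem h1 h))
  rw [LinearEquiv.map_eq_zero_iff] at h3
  exact congrArg Subtype.val h3

theorem target_le_reach {Z A B S T : Submodule 𝕜 U} {ν : S ≃ₗ[𝕜] T}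
    (hν : ∀ s : S, (s : U) + ν s ∈ Z) (hS : S ≤ A) (hT : T ≤ B) : T ≤ reach Z B A :=
  fun x hx => mem_reach.2 ⟨hT hx, _, hS (ν.symm ⟨x, hx⟩).2, by
    simpa [add_comm] using hν (ν.symm ⟨x, hx⟩)⟩

theorem target_le_reach_of_le {Z A B C S T : Submodule 𝕜 U} {ν : S ≃ₗ[𝕜] T}
    (hν : ∀ s : S, (s : U) + ν s ∈ Z) (hS : S ≤ reach Z A C) (hT : T ≤ B) :
    T ≤ reach Z B C := fun x hx => by
  obtain ⟨-, c, hc, h⟩ := mem_reach.1 (hS (ν.symm ⟨x, hx⟩).2)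
  refine mem_reach.2 ⟨hT hx, -c, neg_mem hc, ?_⟩
  have h1 := hν (ν.symm ⟨x, hx⟩)
  rw [LinearEquiv.apply_symm_apply] at h1
  simpa [sub_eq_add_neg] using add_sub_add_mem h1 h

/-- If `Y ≤ Z` contains `Z ⊓ B` and, for each `a` in the reach of `A` into `B`, some element
of `a + B`, then `Y` contains `Z ⊓ (A ⊔ B)`. -/
theorem inf_sup_le_of_forall_reach {Z A B Y : Submodule 𝕜 U} (hYZ : Y ≤ Z) (hB : Z ⊓ B ≤ Y)
    (h : reach Z A B ≤ Y ⊔ B) : Z ⊓ (A ⊔ B) ≤ Y := by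
  rintro z ⟨hz, hzAB⟩
  obtain ⟨a, ha, b, hb, rfl⟩ := Submodule.mem_sup.1 hzAB
  obtain ⟨y, hy, b', hb', rfl⟩ := Submodule.mem_sup.1 (h (mem_reach.2 ⟨ha, b, hb, hz⟩))
  have : b' + b ∈ Y := by
    refine hB ⟨?_, add_mem hb' hb⟩
    simpa [add_assoc] using sub_mem hz (hYZ hy)
  rw [add_assoc]
  exact add_mem hy this

theorem le_sup_of_oplusTwo_le {Y S T B : Submodule 𝕜 U} {ν : S ≃ₗ[𝕜] T} (h : oplusTwo ν ≤ Y)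
    (hT : T ≤ B) : S ≤ Y ⊔ B :=
  left_le_of_oplusTwo_le (h.trans le_sup_left) (hT.trans le_sup_right)

variable {W : Fin 3 → Submodule 𝕜 U} {Z : Submodule 𝕜 U} [FiniteDimensional 𝕜 U]

/-- Vectors of `W 0` reaching both other documents carry the individual and Tian schemes;
complements of these in the single reaches carry two-way schemes, and a complement of `pairSum W Z`
in `Z` carries the triple sums. Dimensions of the remaining parts follow from the isomorphisms. -/
theorem exists_cacheDecomposition (hW : iSupIndep W) (hZ : Z ≤ ⨆ i, W i) :
    ∃ D : CacheDecomposition W Z, (∀ i, D.part i 0 = Z ⊓ W i) ∧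
      Module.finrank 𝕜 (D.part 0 1) + Module.finrank 𝕜 ↥(Z ⊓ W 0) =
        Module.finrank 𝕜 ↥(reach Z (W 0) (W 1) ⊓ reach Z (W 0) (W 2)) ∧
      Module.finrank 𝕜 (D.part 0 2) +
          Module.finrank 𝕜 ↥(reach Z (W 0) (W 1) ⊓ reach Z (W 0) (W 2)) =
        Module.finrank 𝕜 (reach Z (W 0) (W 1)) ∧
      Module.finrank 𝕜 (D.part 0 3) +
          Module.finrank 𝕜 ↥(reach Z (W 0) (W 1) ⊓ reach Z (W 0) (W 2)) =
        Module.finrank 𝕜 (reach Z (W 0) (W 2)) ∧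
      Module.finrank 𝕜 (D.part 1 3) +
          Module.finrank 𝕜 ↥(reach Z (W 1) (W 0) ⊓ reach Z (W 1) (W 2)) =
        Module.finrank 𝕜 (reach Z (W 1) (W 2)) ∧
      Module.finrank 𝕜 (D.part 0 4) + Module.finrank 𝕜 (pairSum W Z) = Module.finrank 𝕜 Z := by
  obtain ⟨π, hπ⟩ := hW.exists_projectionFamily
  have hZA : ∀ i k, Z ⊓ W i ≤ reach Z (W i) (W k) := fun i k => inf_le_reach
  have hRW : ∀ i k, reach Z (W i) (W k) ≤ W i := fun i k => inf_le_left
  have hRZ : ∀ i k, reach Z (W i) (W k) ≤ Z ⊔ W k := fun i k => inf_le_right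
  obtain ⟨A₁, hA₁, hA₁s⟩ := exists_disjoint_sup_eq (le_inf (hZA 0 1) (hZA 0 2))
  obtain ⟨A₂, hA₂, hA₂s⟩ := exists_disjoint_sup_eq
    (inf_le_left : reach Z (W 0) (W 1) ⊓ reach Z (W 0) (W 2) ≤ _)
  obtain ⟨A₃, hA₃, hA₃s⟩ := exists_disjoint_sup_eq
    (inf_le_right : reach Z (W 0) (W 1) ⊓ reach Z (W 0) (W 2) ≤ _)
  obtain ⟨B₃, hB₃, hB₃s⟩ := exists_disjoint_sup_eq
    (inf_le_right : reach Z (W 1) (W 0) ⊓ reach Z (W 1) (W 2) ≤ _)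
  obtain ⟨T, hT, hTs⟩ := exists_disjoint_sup_eq (pairSum_le : pairSum W Z ≤ Z)
  have hA₁E : A₁ ≤ reach Z (W 0) (W 1) ⊓ reach Z (W 0) (W 2) := hA₁s ▸ le_sup_right
  have hA₂R : A₂ ≤ reach Z (W 0) (W 1) := le_sup_right.trans hA₂s.le
  have hA₃R : A₃ ≤ reach Z (W 0) (W 2) := le_sup_right.trans hA₃s.le
  have hB₃R : B₃ ≤ reach Z (W 1) (W 2) := le_sup_right.trans hB₃s.le
  have hTZ : T ≤ Z := hTs ▸ le_sup_right
  have hA₁W := hA₁E.trans (inf_le_left.trans (hRW 0 1))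
  have hA₂W := hA₂R.trans (hRW 0 1)
  have hA₃W := hA₃R.trans (hRW 0 2)
  have hB₃W := hB₃R.trans (hRW 1 2)
  have disj : ∀ {S E V : Submodule 𝕜 U}, S ≤ V → Z ⊓ V ≤ E → Disjoint S E → Disjoint S Z := by
    intro S E V hS hE hd
    exact Submodule.disjoint_def.2 fun x hx hz =>
      Submodule.disjoint_def.1 hd x hx (hE ⟨hz, hS hx⟩)
  have hA₁Z : Disjoint A₁ Z := disj hA₁W le_rfl hA₁
  have hA₂Z : Disjoint A₂ Z := disj hA₂W (le_inf (hZA 0 1) (hZA 0 2)) hA₂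
  have hA₃Z : Disjoint A₃ Z := disj hA₃W (le_inf (hZA 0 1) (hZA 0 2)) hA₃
  have hB₃Z : Disjoint B₃ Z := disj hB₃W (le_inf (hZA 1 0) (hZA 1 2)) hB₃
  have hA₂d : Disjoint A₂ (reach Z (W 0) (W 2)) := Submodule.disjoint_def.2 fun x hx hz =>
    Submodule.disjoint_def.1 hA₂ x hx ⟨hA₂R hx, hz⟩
  have hA₃d : Disjoint A₃ (reach Z (W 0) (W 1)) := Submodule.disjoint_def.2 fun x hx hz =>
    Submodule.disjoint_def.1 hA₃ x hx ⟨hz, hA₃R hx⟩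
  have hB₃d : Disjoint B₃ (reach Z (W 1) (W 0)) := Submodule.disjoint_def.2 fun x hx hz =>
    Submodule.disjoint_def.1 hB₃ x hx ⟨hz, hB₃R hx⟩
  obtain ⟨B₁, hB₁W, ν₁, hν₁⟩ :=
    exists_equiv_add_mem ((hA₁E.trans inf_le_left).trans (hRZ 0 1)) hA₁Z
  obtain ⟨B₂, hB₂W, ν₂, hν₂⟩ := exists_equiv_add_mem (hA₂R.trans (hRZ 0 1)) hA₂Z
  obtain ⟨C₂, hC₂W, ν₃, hν₃⟩ := exists_equiv_add_mem (hA₃R.trans (hRZ 0 2)) hA₃Z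
  obtain ⟨C₃, hC₃W, ν₄, hν₄⟩ := exists_equiv_add_mem (hB₃R.trans (hRZ 1 2)) hB₃Z
  have hB₁Z := disjoint_target_of_disjoint hν₁ hA₁Z
  have hB₁R0 : B₁ ≤ reach Z (W 1) (W 0) := target_le_reach hν₁ hA₁W hB₁W
  have hB₁R2 : B₁ ≤ reach Z (W 1) (W 2) :=
    target_le_reach_of_le hν₁ (hA₁E.trans inf_le_right) hB₁W
  obtain ⟨C₁, hC₁W, ν₅, hν₅⟩ := exists_equiv_add_mem (hB₁R2.trans (hRZ 1 2)) hB₁Z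
  have hC₁Z := disjoint_target_of_disjoint hν₅ hB₁Z
  have hC₁R1 : C₁ ≤ reach Z (W 2) (W 1) := target_le_reach hν₅ hB₁W hC₁W
  have hC₁R0 : C₁ ≤ reach Z (W 2) (W 0) := target_le_reach_of_le hν₅ hB₁R0 hC₁W
  -- A vector of `T` missing one document would lie in `pairSum W Z`; so `T` is the graph of
  -- isomorphisms between its three projections.
  have hinj : ∀ i, Function.Injective (π i ∘ₗ T.subtype) := fun i => by
    rw [injective_iff_map_eq_zero]
    intro t ht
    exact Subtype.ext (Submodule.disjoint_def.1 hT _ t.2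
      (mem_pairSum_of_apply_eq_zero hπ hZ (hTZ t.2) ht))
  set e : ∀ i, T ≃ₗ[𝕜] LinearMap.range (π i ∘ₗ T.subtype) := fun i =>
    LinearEquiv.ofInjective _ (hinj i) with he
  have hd4 : ∀ {i k l : Fin 3}, i ≠ k → i ≠ l → Disjoint (LinearMap.range (π i ∘ₗ T.subtype))
      (reach Z (W i) (W k) ⊔ reach Z (W i) (W l)) := fun hik hil =>
    disjoint_range_reach_sup hπ hZ hTZ hT hik hil
  have hsum : ∀ t : T, π 0 t + π 1 t + π 2 t = t := fun t => by
    rw [← Fin.sum_univ_three (fun i => π i t), hπ.sum_apply (hZ (hTZ t.2))]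
  have hrW : ∀ i, LinearMap.range (π i ∘ₗ T.subtype) ≤ W i := by
    rintro i _ ⟨t, rfl⟩
    exact hπ.mem i t
  have o1 : oplusTwo ν₁ ≤ Z := oplusTwo_le_iff.2 hν₁
  have o2 : oplusTwo ν₂ ≤ Z := oplusTwo_le_iff.2 hν₂
  have o3 : oplusTwo ν₃ ≤ Z := oplusTwo_le_iff.2 hν₃
  have o4 : oplusTwo ν₄ ≤ Z := oplusTwo_le_iff.2 hν₄
  have o5 : oplusTwo ν₅ ≤ Z := oplusTwo_le_iff.2 hν₅
  have o6 : oplusThree ((e 0).symm.trans (e 1)) ((e 0).symm.trans (e 2)) = T := by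
    refine le_antisymm (oplusThree_le_iff.2 fun a => ?_) fun t ht => ⟨e 0 ⟨t, ht⟩, ?_⟩
    · obtain ⟨t, rfl⟩ := (e 0).surjective a
      simp only [LinearEquiv.trans_apply, LinearEquiv.symm_apply_apply]
      exact (hsum t).symm ▸ t.2
    · simp only [LinearMap.add_apply, LinearMap.comp_apply, Submodule.subtype_apply,
        LinearEquiv.coe_coe, LinearEquiv.trans_apply, LinearEquiv.symm_apply_apply]
      exact hsum ⟨t, ht⟩
  -- The span of the chosen pieces. For `Z ≤ Y` it suffices to capture the three two-document
  -- intersections, as `T` is already included.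
  set Y := (Z ⊓ W 0 ⊔ Z ⊓ W 1 ⊔ Z ⊓ W 2) ⊔ (oplusTwo ν₁ ⊔ oplusTwo ν₅) ⊔
    (oplusTwo ν₂ ⊔ oplusTwo ν₃ ⊔ oplusTwo ν₄) ⊔
    oplusThree ((e 0).symm.trans (e 1)) ((e 0).symm.trans (e 2)) with hY
  have hYZ : Y ≤ Z := sup_le (sup_le (sup_le (sup_le (sup_le inf_le_left inf_le_left) inf_le_left)
    (sup_le o1 o5)) (sup_le (sup_le o2 o3) o4)) (o6.le.trans hTZ)
  have hYs := (le_refl Y)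
  conv at hYs => lhs; rw [hY]
  simp only [sup_le_iff] at hYs
  obtain ⟨⟨⟨⟨⟨y0, y1⟩, y2⟩, z1, z5⟩, ⟨z2, z3⟩, z4⟩, z6⟩ := hYs
  have hA₁Y : A₁ ≤ Y ⊔ W 1 := le_sup_of_oplusTwo_le z1 hB₁W
  have hB₁Y : B₁ ≤ Y ⊔ W 2 := le_sup_of_oplusTwo_le z5 hC₁W
  have hA₁Y' : A₁ ≤ Y ⊔ W 2 := left_le_of_oplusTwo_le (z1.trans le_sup_left) hB₁Y
  have hY01 : Z ⊓ (W 0 ⊔ W 1) ≤ Y := by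
    refine inf_sup_le_of_forall_reach hYZ y1 ?_
    rw [← hA₂s, ← hA₁s]
    exact sup_le (sup_le (y0.trans le_sup_left) hA₁Y) (le_sup_of_oplusTwo_le z2 hB₂W)
  have hY02 : Z ⊓ (W 0 ⊔ W 2) ≤ Y := by
    refine inf_sup_le_of_forall_reach hYZ y2 ?_
    rw [← hA₃s, ← hA₁s]
    exact sup_le (sup_le (y0.trans le_sup_left) hA₁Y') (le_sup_of_oplusTwo_le z3 hC₂W)
  -- A partner `a` in `W 0` of such a `b` also reaches `W 2`, so the case of `W 0` applies to `a`;
  -- and `b + a` is in `Y` by `hY01`.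
  have hE1 : reach Z (W 1) (W 0) ⊓ reach Z (W 1) (W 2) ≤ Y ⊔ W 2 := by
    rintro b ⟨hb, hb'⟩
    obtain ⟨hbW, a, ha, hba⟩ := mem_reach.1 hb
    obtain ⟨-, c, hc, hbc⟩ := mem_reach.1 hb'
    have haE : a ∈ Z ⊓ W 0 ⊔ A₁ := by
      rw [hA₁s]
      refine ⟨mem_reach.2 ⟨ha, b, hbW, by rwa [add_comm]⟩,
        mem_reach.2 ⟨ha, -c, neg_mem hc, ?_⟩⟩
      simpa [sub_eq_add_neg] using add_sub_add_mem hba hbc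
    have h1 : a ∈ Y ⊔ W 2 := (sup_le (y0.trans le_sup_left) hA₁Y') haE
    have h2 : b + a ∈ Y := hY01 ⟨hba, add_comm a b ▸ Submodule.add_mem_sup ha hbW⟩
    simpa using sub_mem (Submodule.mem_sup_left h2 : b + a ∈ Y ⊔ W 2) h1
  have hY12 : Z ⊓ (W 1 ⊔ W 2) ≤ Y := by
    refine inf_sup_le_of_forall_reach hYZ y2 ?_
    rw [← hB₃s]
    exact sup_le hE1 (le_sup_of_oplusTwo_le z4 hC₃W)
  have hZY : Z ≤ Y := by
    rw [← hTs]
    exact sup_le (sup_le (sup_le hY01 hY02) hY12) (o6.symm.le.trans z6)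
  let p : Fin 3 → Fin 5 → Submodule 𝕜 U :=
    ![![Z ⊓ W 0, A₁, A₂, A₃, LinearMap.range (π 0 ∘ₗ T.subtype)],
      ![Z ⊓ W 1, B₁, B₂, B₃, LinearMap.range (π 1 ∘ₗ T.subtype)],
      ![Z ⊓ W 2, C₁, C₂, C₃, LinearMap.range (π 2 ∘ₗ T.subtype)]]
  have hp : ∀ i k, p i k ≤ W i := by
    intro i k
    fin_cases i <;> fin_cases k
    exacts [inf_le_right, hA₁W, hA₂W, hA₃W, hrW 0, inf_le_right, hB₁W, hB₂W, hB₃W, hrW 1,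
      inf_le_right, hC₁W, hC₂W, hC₃W, hrW 2]
  have hpi : ∀ i, iSupIndep (p i) := by
    intro i
    fin_cases i
    · exact iSupIndep_five (E₁ := reach Z (W 0) (W 1)) (E₂ := reach Z (W 0) (W 2))
        hA₁ (le_inf (hZA 0 1) (hZA 0 2)) hA₁E hA₂R hA₃R hA₂d hA₃d
        (hd4 (by decide) (by decide))
    · exact iSupIndep_five (E₁ := reach Z (W 1) (W 0)) (E₂ := reach Z (W 1) (W 2))
        (hB₁Z.mono_right inf_le_left) (le_inf (hZA 1 0) (hZA 1 2)) (le_inf hB₁R0 hB₁R2)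
        (target_le_reach hν₂ hA₂W hB₂W) hB₃R
        (disjoint_target_of_disjoint_source hν₂ hA₂W hA₂d) hB₃d
        (hd4 (by decide) (by decide))
    · exact iSupIndep_five (E₁ := reach Z (W 2) (W 0)) (E₂ := reach Z (W 2) (W 1))
        (hC₁Z.mono_right inf_le_left) (le_inf (hZA 2 0) (hZA 2 1)) (le_inf hC₁R0 hC₁R1)
        (target_le_reach hν₃ hA₃W hC₂W) (target_le_reach hν₄ hB₃W hC₃W)
        (disjoint_target_of_disjoint_source hν₃ hA₃W hA₃d)
        (disjoint_target_of_disjoint_source hν₄ hB₃W hB₃d)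
        (hd4 (by decide) (by decide))
  refine ⟨⟨p, hp, hpi, ν₁, ν₅, ν₂, ν₃, ν₄, (e 0).symm.trans (e 1), (e 0).symm.trans (e 2),
    le_antisymm hZY hYZ⟩, ?_, ?_, ?_, ?_, ?_, ?_⟩
  · intro i
    fin_cases i <;> rfl
  · exact finrank_add_of_disjoint_sup_eq hA₁ hA₁s
  · exact finrank_add_of_disjoint_sup_eq hA₂ hA₂s
  · exact finrank_add_of_disjoint_sup_eq hA₃ hA₃s
  · exact finrank_add_of_disjoint_sup_eq hB₃ hB₃s
  · rw [← finrank_add_of_disjoint_sup_eq hT hTs, (e 0).finrank_eq]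
    rfl

end Construction

/-! ### Symmetric schemes have ratios -/

namespace LinearCachingScheme

variable {𝕜 U : Type*} [Field 𝕜] [AddCommGroup U] [Module 𝕜 U] {F : ℕ}
  {S : LinearCachingScheme 𝕜 U 3 3 F}

theorem map_reach (e : U ≃ₗ[𝕜] U) (Z A B : Submodule 𝕜 U) :
    (reach Z A B).map e.toLinearMap =
      reach (Z.map e.toLinearMap) (A.map e.toLinearMap) (B.map e.toLinearMap) := by
  rw [reach, Submodule.map_inf _ e.injective, Submodule.map_sup, reach]

theorem IsSymmetric.exists_equiv (h : S.IsSymmetric) (j : Fin 3) {i k l : Fin 3} (hik : i ≠ k)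
    (hil : i ≠ l) (hkl : k ≠ l) : ∃ e : U ≃ₗ[𝕜] U, (S.Z 0).map e.toLinearMap = S.Z j ∧
      (S.W 0).map e.toLinearMap = S.W i ∧ (S.W 1).map e.toLinearMap = S.W k ∧
      (S.W 2).map e.toLinearMap = S.W l := by
  have hperm : ∀ i k l : Fin 3, i ≠ k → i ≠ l → k ≠ l →
      ∃ ν : Equiv.Perm (Fin 3), ν 0 = i ∧ ν 1 = k ∧ ν 2 = l := by decide
  obtain ⟨ν, h0, h1, h2⟩ := hperm i k l hik hil hkl
  obtain ⟨e, hW, hZ, -⟩ := h (Equiv.swap 0 j) ν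
  refine ⟨e, ?_, ?_, ?_, ?_⟩
  · rw [hZ, Equiv.swap_apply_left]
  · rw [hW, h0]
  · rw [hW, h1]
  · rw [hW, h2]

theorem IsSymmetric.finrank_eq (h : S.IsSymmetric) (j : Fin 3) {i k l : Fin 3} (hik : i ≠ k)
    (hil : i ≠ l) (hkl : k ≠ l) :
    Module.finrank 𝕜 ↥(S.Z j ⊓ S.W i) = Module.finrank 𝕜 ↥(S.Z 0 ⊓ S.W 0) ∧
      Module.finrank 𝕜 (reach (S.Z j) (S.W i) (S.W k)) =
        Module.finrank 𝕜 (reach (S.Z 0) (S.W 0) (S.W 1)) ∧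
      Module.finrank 𝕜 ↥(reach (S.Z j) (S.W i) (S.W k) ⊓ reach (S.Z j) (S.W i) (S.W l)) =
        Module.finrank 𝕜 ↥(reach (S.Z 0) (S.W 0) (S.W 1) ⊓ reach (S.Z 0) (S.W 0) (S.W 2)) := by
  obtain ⟨e, hZ, h0, h1, h2⟩ := h.exists_equiv j hik hil hkl
  rw [← hZ, ← h0, ← h1, ← h2, ← Submodule.map_inf _ e.injective, ← map_reach, ← map_reach,
    ← Submodule.map_inf _ e.injective]
  exact ⟨e.finrank_map_eq _, e.finrank_map_eq _, e.finrank_map_eq _⟩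

theorem IsSymmetric.finrank_cache_eq (h : S.IsSymmetric) (j : Fin 3) :
    Module.finrank 𝕜 (S.Z j) = Module.finrank 𝕜 (S.Z 0) ∧
      Module.finrank 𝕜 (pairSum S.W (S.Z j)) = Module.finrank 𝕜 (pairSum S.W (S.Z 0)) := by
  obtain ⟨e, hZ, h0, h1, h2⟩ := h.exists_equiv j (i := 0) (k := 1) (l := 2) (by decide)
    (by decide) (by decide)
  have hp : (pairSum S.W (S.Z 0)).map e.toLinearMap = pairSum S.W (S.Z j) := by
    simp only [pairSum, Submodule.map_sup, Submodule.map_inf _ e.injective, hZ, h0, h1, h2]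
  rw [← hp, ← hZ]
  exact ⟨e.finrank_map_eq _, e.finrank_map_eq _⟩

theorem IsSymmetric.exists_hasRatios [FiniteDimensional 𝕜 U] (h : S.IsSymmetric) (hF : 0 < F)
    (hS : S.IsSeparated) : ∃ r₁ r₂ r₃ r₄ r₅ : ℝ, S.HasRatios r₁ r₂ r₃ r₄ r₅ := by
  obtain ⟨P, -, hPW, -, hZ⟩ := hS
  have hF' : (F : ℝ) ≠ 0 := by exact_mod_cast hF.ne'
  have hZW : ∀ j, S.Z j ≤ ⨆ i, S.W i := fun j =>
    (hZ j).trans (iSup_mono fun i => hPW i ▸ le_iSup (P i) j)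
  choose D hD0 hD1 hD2 hD3 hD3' hD4 using fun j => exists_cacheDecomposition S.indep_W (hZW j)
  have key : ∀ j i, Module.finrank 𝕜 ((D j).part i 0) = Module.finrank 𝕜 ((D 0).part 0 0) ∧
      Module.finrank 𝕜 ((D j).part i 1) = Module.finrank 𝕜 ((D 0).part 0 1) ∧
      Module.finrank 𝕜 ((D j).part i 2) = Module.finrank 𝕜 ((D 0).part 0 2) ∧
      Module.finrank 𝕜 ((D j).part i 3) = Module.finrank 𝕜 ((D 0).part 0 2) ∧
      Module.finrank 𝕜 ((D j).part i 4) = Module.finrank 𝕜 ((D 0).part 0 4) := by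
    intro j i
    obtain ⟨z0, a1, e1⟩ := h.finrank_eq j (i := 0) (k := 1) (l := 2) (by decide) (by decide)
      (by decide)
    obtain ⟨-, a2, -⟩ := h.finrank_eq j (i := 0) (k := 2) (l := 1) (by decide) (by decide)
      (by decide)
    obtain ⟨z1, a3, -⟩ := h.finrank_eq j (i := 1) (k := 2) (l := 0) (by decide) (by decide)
      (by decide)
    obtain ⟨-, -, e3⟩ := h.finrank_eq j (i := 1) (k := 0) (l := 2) (by decide) (by decide)
      (by decide)
    obtain ⟨z2, -, -⟩ := h.finrank_eq j (i := 2) (k := 0) (l := 1) (by decide) (by decide)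
      (by decide)
    obtain ⟨c1, c2⟩ := h.finrank_cache_eq j
    have d1 := hD1 j
    have d2 := hD2 j
    have d3 := hD3 j
    have d3' := hD3' j
    have d4 := hD4 j
    have f1 := hD1 0
    have f2 := hD2 0
    have f4 := hD4 0
    have t1 := (D j).tianAB.finrank_eq
    have t2 := (D j).tianBC.finrank_eq
    have p1 := (D j).pairAB.finrank_eq
    have p2 := (D j).pairAC.finrank_eq
    have p3 := (D j).pairBC.finrank_eq
    have q1 := (D j).tripleAB.finrank_eq
    have q2 := (D j).tripleAC.finrank_eq
    rw [hD0, hD0]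
    have hi : i = 0 ∨ i = 1 ∨ i = 2 := by omega
    rcases hi with rfl | rfl | rfl <;> refine ⟨by omega, by omega, by omega, by omega, by omega⟩
  -- The factor `2` in `r₃` appears because each of the two two-way parts of a document has
  -- dimension `F r₃ / 2`.
  refine ⟨Module.finrank 𝕜 ((D 0).part 0 0) / F, Module.finrank 𝕜 ((D 0).part 0 1) / F,
    2 * Module.finrank 𝕜 ((D 0).part 0 2) / F, Module.finrank 𝕜 ((D 0).part 0 4) / F,
    (F - Module.finrank 𝕜 ↥(⨆ j, ⨆ k, (D j).part 0 k)) / (3 * F), D, fun j i => ?_, ?_⟩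
  · obtain ⟨k0, k1, k2, k3, k4⟩ := key j i
    rw [k0, k1, k2, k3, k4]
    refine ⟨?_, ?_, ?_, ?_, ?_⟩ <;> field_simp
  · field_simp

end LinearCachingScheme

theorem mainTheorem10 {𝕜 : Type*} {U : Type*} [Field 𝕜] [AddCommGroup U] [Module 𝕜 U]
    [FiniteDimensional 𝕜 U] {F : ℕ} (hF : 0 < F) (S : LinearCachingScheme 𝕜 U 3 3 F)
    (hS : S.IsSeparated) (M R : ℝ) (hMR : S.Achieves M R) :
    (S.IsSymmetric → ∃ r₁ r₂ r₃ r₄ r₅ : ℝ, S.HasRatios r₁ r₂ r₃ r₄ r₅) ∧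
    (∀ r₁ r₂ r₃ r₄ r₅ : ℝ, S.HasRatios r₁ r₂ r₃ r₄ r₅ →
      2 * R + 3 * M ≥ 5 - 3 / 2 * r₃ + 3 * r₅ ∧
      6 * M + 5 * R ≥ 11 + 3 * r₄ + 15 / 2 * r₅) ∧
    6 * M + 5 * R ≥ 11 :=
  ⟨fun h => h.exists_hasRatios hF hS, fun _ _ _ _ _ h => h.bounds hF hMR hS,
    hMR.six_mul_add_five_mul_ge hF hS⟩
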